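/- There are $n$ buyers with independent values $v_i\sim F_i$, where each $F_i$ is a probability distribution on $[0,\infty)$ (also denoting its CDF), possibly different for different buyers. A nonempty downward-closed family $\mathcal X\subseteq 2^{[n]}$ gives the sets of buyers who can win simultaneously; a feasible (randomized) allocation is a convex combination of indicator vectors of sets in $\mathcal X$. * $F$ is *quasi-MHR* if $v\mapsto \frac{-\ln(1-F(v))}{v}$ (with value $+\infty$ where $F(v)=1$) is weakly increasing on $(0,\infty)$. $F$ is *MHR* if its hazard rate $h=\frac{F'}{1-F}$ is weakly increasing where $F<1$, i.e. there is a nonnegative weakly increasing $h$ on $\{v\ge 0: F(v)<1\}$ with $1-F(v)=\exp\left(-\int_0^v h(x)\,dx\right)$ there (a probability mass at the supremum of the support is allowed). * $\mathrm{BOM}(\mathcal X,\mathbf F)$, the revenue of the Bayesian optimal mechanism, is the supremum of the expected revenue over all feasible, Bayesian incentive compatible, interim individually rational mechanisms with nonnegative payments. $\mathrm{OPT}(\mathcal X,\mathbf F)=\mathbb E\left[\max_{S\in\mathcal X}\sum_{i\in S}v_i\right]$ is the optimal expected welfare. * $\mathrm{VCG}_{\oplus n}(\mathcal X,\mathbf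 F)$ is the expected revenue of the VCG auction (a welfare-maximizing feasible set wins, ties broken arbitrarily, and each buyer pays her externality on the others) in the duplicated environment: every buyer $i$ gets a duplicate with an independent value from $F_i$, a buyer and her duplicate cannot both win, and the winners, read as original buyers, must form a set in $\mathcal X$. **Theorem.** 1. For all $n$, all downward-closed $\mathcal X$ and all quasi-MHR $F_1,\dots,F_n$, $$\mathrm{VCG}_{\oplus n}(\mathcal X,\mathbf F)\ \ge\ \tfrac13\,\mathrm{BOM}(\mathcal X,\mathbf F),$$ and $\tfrac13$ is the largest constant for which this holds for all such instances. 2. The same is true, with the same largest constant $\tfrac13$, when $\mathrm{BOM}$ is replaced by the optimal welfare $\mathrm{OPT}$. 3. Every MHR distribution is quasi-MHR, and $\tfrac13$ is also the largest constant for which the inequality in 1 holds for all $n$, all downward-closed $\mathcal X$ and all MHR $F_1,\dots,F_n$. (Thus the tightness already holds for asymmetric MHR buyers, and the passage from MHR to quasi-MHR buyers loses nothing.) -/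

import Mathlib

open MeasureTheory ProbabilityTheory
open scoped ENNReal

noncomputable section

namespace DuplicateVCG

/-! Valuation distributions -/

/-- A valuation distribution: a probability measure on `[0, ∞)`. -/
structure IsValuation (μ : Measure ℝ) : Prop where
  isProbabilityMeasure : IsProbabilityMeasure μ
  nonneg : μ (Set.Iio 0) = 0

/-- The conditional expected (i.e. averaged) hazard rate `-ln (1 - F v) / v`, for `v > 0` and
`F v < 1`; where `F v = 1` its value is `+∞`. -/
def avgHazardRate (μ : Measure ℝ) (v : ℝ) : ℝ :=
  -Real.log (1 - cdf μ v) / v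

/-- Quasi-MHR: the conditional expected hazard rate is weakly increasing on `(0, ∞)`. Where
`F v = 1` it equals `+∞`, so that only the values with `F v < 1` impose a condition. Probability
masses are allowed. -/
structure IsQuasiMHR (μ : Measure ℝ) : Prop extends IsValuation μ where
  monotoneOn : MonotoneOn (avgHazardRate μ) {v | 0 < v ∧ cdf μ v < 1}

/-- MHR: there is a weakly increasing hazard rate `h` on `{v ≥ 0 | F v < 1}`, where
`h = F' / (1 - F)` is expressed in integrated form `1 - F v = exp (-∫₀ᵛ h)`. A probability mass
can occur only at the supremum of the support. -/
structure IsMHR (μ : Measure ℝ) : Prop extends IsValuation μ where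
  exists_hazardRate : ∃ h : ℝ → ℝ,
    MonotoneOn h {v | 0 ≤ v ∧ cdf μ v < 1} ∧
    (∀ v, 0 ≤ v → cdf μ v < 1 → 0 ≤ h v) ∧
    ∀ v, 0 ≤ v → cdf μ v < 1 → 1 - cdf μ v = Real.exp (-∫ x in (0 : ℝ)..v, h x)

/-! Downward-closed settings and welfare -/

section

variable {ι : Type*} [Fintype ι] [DecidableEq ι]

/-- A nonempty family of feasible sets of winners that is closed under taking subsets. -/
structure IsDownwardClosed (X : Set (Finset ι)) : Prop where
  nonempty : X.Nonempty
  isLowerSet : IsLowerSet X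

/-- The largest welfare `∑ i ∈ S, v i` of a feasible set `S` (a maximum over a finite family). -/
def maxWelfare (X : Set (Finset ι)) (v : ι → ℝ) : ℝ :=
  sSup ((fun S : Finset ι => ∑ i ∈ S, v i) '' X)

/-- The optimal expected welfare, for independent values `v i ∼ F i`. -/
def optimalWelfare (X : Set (Finset ι)) (F : ι → Measure ℝ) : ℝ≥0∞ :=
  ∫⁻ v, ENNReal.ofReal (maxWelfare X v) ∂(Measure.pi F)

/-! Mechanisms -/

/-- The 0/1 allocation in which exactly the buyers in `S` win. -/
def allocationOf (S : Finset ι) : ι → ℝ := fun i => if i ∈ S then 1 else 0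

end

/-- A direct mechanism: it maps the reported values to an allocation and to payments
(in expectation over the mechanism's own randomness). -/
structure Mechanism (ι : Type*) where
  alloc : (ι → ℝ) → ι → ℝ
  pay : (ι → ℝ) → ι → ℝ

section

variable {ι : Type*} [Fintype ι] [DecidableEq ι]

/-- Expected revenue under truthful reports (all mechanisms below have payments `≥ 0`). -/
def Mechanism.revenue (M : Mechanism ι) (F : ι → Measure ℝ) : ℝ≥0∞ :=
  ∫⁻ v, ENNReal.ofReal (∑ i, M.pay v i) ∂(Measure.pi F)

/-- Interim allocation of buyer `i` who reports `s`. -/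
def Mechanism.interimAlloc (M : Mechanism ι) (F : ι → Measure ℝ) (i : ι) (s : ℝ) : ℝ :=
  ∫ v, M.alloc (Function.update v i s) i ∂(Measure.pi F)

/-- Interim payment of buyer `i` who reports `s`. -/
def Mechanism.interimPay (M : Mechanism ι) (F : ι → Measure ℝ) (i : ι) (s : ℝ) : ℝ :=
  ∫ v, M.pay (Function.update v i s) i ∂(Measure.pi F)

/-- Feasible, Bayesian incentive compatible and interim individually rational mechanisms with
nonnegative payments; allocations are convex combinations of feasible sets. -/
structure Mechanism.IsAdmissible (M : Mechanism ι) (X : Set (Finset ι))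
    (F : ι → Measure ℝ) : Prop where
  measurable_alloc : Measurable M.alloc
  measurable_pay : Measurable M.pay
  feasible : ∀ v, M.alloc v ∈ convexHull ℝ (allocationOf '' X)
  pay_nonneg : ∀ v i, 0 ≤ M.pay v i
  integrable_pay : ∀ i, ∀ s ∈ (F i).support,
    Integrable (fun v => M.pay (Function.update v i s) i) (Measure.pi F)
  incentive_compatible : ∀ i, ∀ s ∈ (F i).support, ∀ s' ∈ (F i).support,
    s * M.interimAlloc F i s' - M.interimPay F i s'
      ≤ s * M.interimAlloc F i s - M.interimPay F i s
  individually_rational : ∀ i, ∀ s ∈ (F i).support,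
    0 ≤ s * M.interimAlloc F i s - M.interimPay F i s

/-- The revenue of the Bayesian optimal mechanism. -/
def optimalRevenue (X : Set (Finset ι)) (F : ι → Measure ℝ) : ℝ≥0∞ :=
  ⨆ (M : Mechanism ι) (_ : M.IsAdmissible X F), M.revenue F

/-- A VCG auction: the winners form a feasible set of maximum welfare (ties broken arbitrarily),
and every buyer `i` pays the externality that she imposes on the others, i.e. the maximum welfare
without her minus the welfare of the other winners (this is `0` for a loser, and for a winner it
is the threshold value for winning). -/
def Mechanism.IsVCG (M : Mechanism ι) (X : Set (Finset ι)) : Prop :=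
  ∀ v, ∃ S ∈ X, (∀ T ∈ X, ∑ i ∈ T, v i ≤ ∑ i ∈ S, v i) ∧
    M.alloc v = allocationOf S ∧
    ∀ i, M.pay v i = maxWelfare {T ∈ X | i ∉ T} v - ∑ j ∈ S.erase i, v j

/-- Feasible sets after duplicating every buyer: a buyer and her duplicate do not both win, and
the winners form a feasible set when read as original buyers. The buyers `(i, false)` and
`(i, true)` are buyer `i` and her duplicate. -/
def duplicateFeasible (X : Set (Finset ι)) : Set (Finset (ι × Bool)) :=
  {T | (∀ i, ¬ ((i, false) ∈ T ∧ (i, true) ∈ T)) ∧ T.image Prod.fst ∈ X}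

end

/-- The value distributions after duplicating every buyer. -/
def duplicatePrior {ι : Type*} (F : ι → Measure ℝ) : ι × Bool → Measure ℝ := fun b => F b.1

/-- For all numbers `n` of buyers, all downward-closed settings and all (possibly different)
distributions `F i` of the class `P`, the `n`-duplicate VCG auction earns at least a fraction `c`
of the benchmark `B` of the original setting without duplicates. -/
def VCGGuarantee (P : Measure ℝ → Prop)
    (B : (n : ℕ) → Set (Finset (Fin n)) → (Fin n → Measure ℝ) → ℝ≥0∞) (c : ℝ≥0∞) : Prop :=
  ∀ (n : ℕ) (X : Set (Finset (Fin n))) (F : Fin n → Measure ℝ) (M : Mechanism (Fin n × Bool)),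
    IsDownwardClosed X → (∀ i, P (F i)) → M.IsVCG (duplicateFeasible X) →
    c * B n X F ≤ M.revenue (duplicatePrior F)

end DuplicateVCG

end

noncomputable section

namespace DuplicateVCG

/-! ### Maximum welfare as a function of the values -/

section Welfare

variable {ι : Type*}

/-! Lower bound. With duplicates, a pair competes through its higher value, and a winner's duplicate
caps the discount at the gap to the lower value. Hence, however ties are broken, VCG earns the
welfare `W` of the high values minus, for each `i`, the welfare lost when `i` drops from her high to
her low value (`Mechanism.IsVCG.sum_pay`). Fix everything but pair `i`: she faces a threshold `t ≥
0`, contributes `max` of the pair to welfare when `max > t`, and then pays `max t min`. Put `T = t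
P(max > t)`, `A = E(max - t)⁺`, `B = E(min - t)⁺`. Exchanging the pair for its two values gives `A +
B = 2 E(v - t)⁺`, and `E(v - t)⁺ ≤ T + E(v - 2t)⁺`. Quasi-MHR yields `P(v > 2x) ≤ P(v > x)²`, so
`min` dominates `v / 2` and `E(v - 2t)⁺ ≤ 2B`. Therefore `A ≤ 2T + 3B`, that is, `T + A ≤ 3 (T + B)`
(`IsQuasiMHR.lintegral_value_le`). The welfare not attributed to pivotal buyers enters welfare and
revenue equally. Summing over buyers gives `lintegral_maxWelfare_highValue_le`; the high-value
welfare dominates the optimal welfare, which dominates the optimal revenue by individual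
rationality.

Tightness. One buyer with known value slightly below `3k/2` competes with `k` Exp(1) buyers who can
all win together. Charging the known value earns about `3k/2`. With duplicates, the exponential side
has welfare near `k E max = 3k/2`, so it typically wins with a margin linear in `k`; hardly any
winner is pivotal against the known value, and each pays essentially her duplicate's value, of mean
`E min = 1/2`. Revenue is `k/2 + O(1)` for a fixed relative margin (`revenue_oneOrOthers_le`,
`VCGGuarantee.le_third`). -/

theorem IsDownwardClosed.empty_mem {X : Set (Finset ι)} (hX : IsDownwardClosed X) : ∅ ∈ X := by
  obtain ⟨S, hS⟩ := hX.nonempty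
  exact hX.isLowerSet (Finset.empty_subset S) hS

theorem maxWelfare_le {X : Set (Finset ι)} (hX : X.Nonempty) {v : ι → ℝ} {a : ℝ}
    (h : ∀ S ∈ X, ∑ i ∈ S, v i ≤ a) : maxWelfare X v ≤ a :=
  csSup_le (hX.image _) (by rintro _ ⟨S, hS, rfl⟩; exact h S hS)

variable [Fintype ι]

theorem le_maxWelfare {X : Set (Finset ι)} {S : Finset ι} (hS : S ∈ X) (v : ι → ℝ) :
    ∑ i ∈ S, v i ≤ maxWelfare X v :=
  le_csSup ((Set.toFinite X).image _).bddAbove ⟨S, hS, rfl⟩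

theorem exists_maxWelfare_eq {X : Set (Finset ι)} (hX : X.Nonempty) (v : ι → ℝ) :
    ∃ S ∈ X, maxWelfare X v = ∑ i ∈ S, v i := by
  obtain ⟨S, hS, h⟩ := (hX.image fun S : Finset ι => ∑ i ∈ S, v i).csSup_mem
    ((Set.toFinite X).image _)
  exact ⟨S, hS, h.symm⟩

theorem maxWelfare_mono {X : Set (Finset ι)} (hX : X.Nonempty) {v w : ι → ℝ} (h : v ≤ w) :
    maxWelfare X v ≤ maxWelfare X w :=
  maxWelfare_le hX fun _ hS => (Finset.sum_le_sum fun i _ => h i).trans (le_maxWelfare hS w)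

theorem measurable_maxWelfare (X : Set (Finset ι)) : Measurable (maxWelfare X) := by
  have h : maxWelfare X = fun v => ⨆ S : X, ∑ i ∈ (S : Finset ι), v i := by
    funext v
    rw [maxWelfare, sSup_image']
  rw [h]
  exact Measurable.iSup fun _ => by fun_prop

variable [DecidableEq ι]

/-- As a function of the value of a single buyer, the maximum welfare is constant (the buyer can
never win) or has a nonnegative threshold value for winning, above which its slope is one. -/
theorem maxWelfare_update {X : Set (Finset ι)} (hX : IsDownwardClosed X) (i : ι) (w : ι → ℝ) :
    ∃ a : ℝ, (∀ x, maxWelfare X (Function.update w i x) = a) ∨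
      ∃ t, 0 ≤ t ∧ ∀ x, maxWelfare X (Function.update w i x) = max a (a + x - t) := by
  have hsum : ∀ (S : Finset ι) (x : ℝ), i ∉ S →
      ∑ j ∈ S, Function.update w i x j = ∑ j ∈ S, w j := fun S x hS =>
    Finset.sum_congr rfl fun j hj => Function.update_of_ne (ne_of_mem_of_not_mem hj hS) _ _
  have hsum' : ∀ (S : Finset ι) (x : ℝ), i ∈ S →
      ∑ j ∈ S, Function.update w i x j = ∑ j ∈ S.erase i, w j + x := fun S x hS => by
    rw [← Finset.sum_erase_add _ _ hS, hsum _ _ (Finset.notMem_erase i S), Function.update_self]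
  obtain ⟨S, ⟨hSX, hiS⟩, hS⟩ := exists_maxWelfare_eq
    (X := {T ∈ X | i ∉ T}) ⟨∅, hX.empty_mem, by simp⟩ w
  refine ⟨maxWelfare {T ∈ X | i ∉ T} w, ?_⟩
  by_cases hY : ∃ T ∈ X, i ∈ T
  · right
    -- Valuing `i` at `0` makes `T` the best set containing `i` for the other buyers alone.
    obtain ⟨T, ⟨hTX, hiT⟩, hT⟩ := exists_maxWelfare_eq
      (X := {T ∈ X | i ∈ T}) hY (Function.update w i 0)
    rw [hsum' T 0 hiT, add_zero] at hT
    -- The threshold is what the others lose when `i` wins; it is nonnegative because `T.erase i` is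
    -- itself feasible without `i`.
    refine ⟨maxWelfare {T ∈ X | i ∉ T} w - ∑ j ∈ T.erase i, w j, ?_, fun x => ?_⟩
    · exact sub_nonneg.2 (le_maxWelfare (X := {T ∈ X | i ∉ T})
        ⟨hX.isLowerSet (Finset.erase_subset i T) hTX, Finset.notMem_erase i T⟩ w)
    · apply le_antisymm
      · refine maxWelfare_le hX.nonempty fun U hU => ?_
        by_cases hiU : i ∈ U
        · have := le_maxWelfare (X := {T ∈ X | i ∈ T}) ⟨hU, hiU⟩ (Function.update w i 0)
          rw [hT, hsum' U 0 hiU] at this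
          rw [hsum' U x hiU]
          exact le_max_of_le_right (by linarith)
        · rw [hsum U x hiU]
          exact le_max_of_le_left (le_maxWelfare (X := {T ∈ X | i ∉ T}) ⟨hU, hiU⟩ w)
      · refine max_le ?_ ?_
        · rw [hS, ← hsum S x hiS]
          exact le_maxWelfare hSX _
        · refine le_trans (le_of_eq ?_) (le_maxWelfare hTX _)
          rw [hsum' T x hiT]
          ring
  · left
    push Not at hY
    intro x
    apply le_antisymm
    · refine maxWelfare_le hX.nonempty fun U hU => ?_
      rw [hsum U x (hY U hU)]
      exact le_maxWelfare (X := {T ∈ X | i ∉ T}) ⟨hU, hY U hU⟩ w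
    · rw [hS, ← hsum S x hiS]
      exact le_maxWelfare hSX _

end Welfare

/-! ### Reduction of the duplicated environment to high and low values -/

section Duplicates

variable {ι : Type*}

/-- The larger value of every buyer and her duplicate. -/
def highValue (z : ι × Bool → ℝ) (i : ι) : ℝ := max (z (i, false)) (z (i, true))

/-- The smaller value of every buyer and her duplicate. -/
def lowValue (z : ι × Bool → ℝ) (i : ι) : ℝ := min (z (i, false)) (z (i, true))

theorem le_highValue (z : ι × Bool → ℝ) (b : ι × Bool) : z b ≤ highValue z b.1 := by
  obtain ⟨i, _ | _⟩ := b
  · exact le_max_left _ _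
  · exact le_max_right _ _

theorem lowValue_le_highValue (z : ι × Bool → ℝ) (i : ι) : lowValue z i ≤ highValue z i :=
  min_le_max

theorem measurable_highValue : Measurable (highValue : (ι × Bool → ℝ) → ι → ℝ) :=
  measurable_pi_lambda _ fun _ => by unfold highValue; fun_prop

theorem measurable_lowValue : Measurable (lowValue : (ι × Bool → ℝ) → ι → ℝ) :=
  measurable_pi_lambda _ fun _ => by unfold lowValue; fun_prop

theorem measurePreserving_originals [Fintype ι] {F : ι → Measure ℝ} (hF : ∀ i, IsProbabilityMeasure (F i)) :
    MeasurePreserving (fun (z : ι × Bool → ℝ) i => z (i, false))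
      (Measure.pi (duplicatePrior F)) (Measure.pi F) := by
  have hprob : ∀ b, IsProbabilityMeasure (duplicatePrior F b) := fun b => hF b.1
  have hm : Measurable fun (z : ι × Bool → ℝ) (i : ι) => z (i, false) := by fun_prop
  refine ⟨hm, (Measure.pi_eq fun s hs => ?_).symm⟩
  rw [Measure.map_apply hm (MeasurableSet.univ_pi hs)]
  have : (fun (z : ι × Bool → ℝ) i => z (i, false)) ⁻¹' Set.univ.pi s =
      Set.univ.pi fun b : ι × Bool => if b.2 then Set.univ else s b.1 := by
    ext z
    simp [Set.mem_pi]
  rw [this, Measure.pi_pi, Fintype.prod_prod_type]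
  refine Finset.prod_congr rfl fun i _ => ?_
  simp [duplicatePrior]

theorem optimalWelfare_le [Fintype ι] {X : Set (Finset ι)} (hX : X.Nonempty) {F : ι → Measure ℝ}
    (hF : ∀ i, IsProbabilityMeasure (F i)) : optimalWelfare X F ≤
      ∫⁻ z, ENNReal.ofReal (maxWelfare X (highValue z)) ∂(Measure.pi (duplicatePrior F)) := by
  rw [optimalWelfare, ← (measurePreserving_originals hF).lintegral_comp
    (measurable_maxWelfare X).ennreal_ofReal]
  exact lintegral_mono fun z =>
    ENNReal.ofReal_le_ofReal (maxWelfare_mono hX fun i => le_max_left _ _)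

variable [DecidableEq ι]

theorem highValue_update_update (z : ι × Bool → ℝ) (i : ι) (x y : ℝ) :
    highValue (Function.update (Function.update z (i, false) x) (i, true) y) =
      Function.update (highValue z) i (max x y) := by
  ext j
  by_cases h : j = i
  · subst h
    simp [highValue]
  · simp [highValue, h]

theorem lowValue_update_update (z : ι × Bool → ℝ) (i : ι) (x y : ℝ) :
    lowValue (Function.update (Function.update z (i, false) x) (i, true) y) i = min x y := by
  simp [lowValue]

theorem sum_image_fst {X : Set (Finset ι)} {T : Finset (ι × Bool)}
    (hT : T ∈ duplicateFeasible X) (f : ι → ℝ) :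
    ∑ i ∈ T.image Prod.fst, f i = ∑ b ∈ T, f b.1 := by
  refine Finset.sum_image ?_
  rintro ⟨i, b⟩ hb ⟨j, c⟩ hc (rfl : i = j)
  rw [Finset.mem_coe] at hb hc
  have h := hT.1 i
  cases b <;> cases c <;> simp_all

/-- Choosing one copy of each buyer of a feasible set gives a feasible set with duplicates. -/
theorem image_copy_mem {X : Set (Finset ι)} {S : Finset ι} (hS : S ∈ X) (c : ι → Bool) :
    S.image (fun i => (i, c i)) ∈ duplicateFeasible X := by
  refine ⟨fun i => ?_, ?_⟩
  · simp only [Finset.mem_image, Prod.mk.injEq]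
    rintro ⟨⟨j, -, rfl, h⟩, ⟨k, -, rfl, h'⟩⟩
    simp [h] at h'
  · rw [Finset.image_image]
    simpa [Function.comp_def] using hS

variable [Fintype ι]

/-- Each winner is worth at most the higher copy, and choosing the higher copy of every buyer is
feasible. -/
theorem maxWelfare_duplicateFeasible {X : Set (Finset ι)} (hX : X.Nonempty)
    (z : ι × Bool → ℝ) : maxWelfare (duplicateFeasible X) z = maxWelfare X (highValue z) := by
  have hD : (duplicateFeasible X).Nonempty :=
    hX.elim fun S hS => ⟨_, image_copy_mem hS fun _ => false⟩
  apply le_antisymm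
  · refine maxWelfare_le hD fun T hT => ?_
    calc ∑ b ∈ T, z b ≤ ∑ b ∈ T, highValue z b.1 := Finset.sum_le_sum fun b _ => le_highValue z b
      _ = ∑ i ∈ T.image Prod.fst, highValue z i := (sum_image_fst hT _).symm
      _ ≤ maxWelfare X (highValue z) := le_maxWelfare hT.2 _
  · refine maxWelfare_le hX fun S hS => ?_
    refine le_trans (le_of_eq ?_)
      (le_maxWelfare (image_copy_mem hS fun i => decide (z (i, false) ≤ z (i, true))) z)
    rw [Finset.sum_image (by simp)]
    refine Finset.sum_congr rfl fun i _ => ?_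
    by_cases h : z (i, false) ≤ z (i, true)
    · simp [highValue, h]
    · simp [highValue, h, le_of_not_ge h]

theorem maxWelfare_duplicateFeasible_without {X : Set (Finset ι)} (hX : IsDownwardClosed X)
    (z : ι × Bool → ℝ) (i : ι) (β : Bool) :
    maxWelfare {T ∈ duplicateFeasible X | (i, β) ∉ T} z =
      maxWelfare X (Function.update (highValue z) i (z (i, !β))) := by
  have hD : {T ∈ duplicateFeasible X | (i, β) ∉ T}.Nonempty :=
    ⟨∅, by simpa using image_copy_mem hX.empty_mem fun _ => false, by simp⟩
  apply le_antisymm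
  · refine maxWelfare_le hD fun T hT => ?_
    calc ∑ b ∈ T, z b ≤ ∑ b ∈ T, Function.update (highValue z) i (z (i, !β)) b.1 := by
          refine Finset.sum_le_sum fun b hb => ?_
          obtain ⟨j, γ⟩ := b
          by_cases hj : j = i
          · subst hj
            have hγ : γ ≠ β := fun h => hT.2 (h ▸ hb)
            have : γ = !β := by cases γ <;> cases β <;> simp_all
            simp [this]
          · rw [Function.update_of_ne hj]
            exact le_highValue z (j, γ)
      _ = ∑ i' ∈ T.image Prod.fst, _ := (sum_image_fst hT.1 _).symm
      _ ≤ _ := le_maxWelfare hT.1.2 _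
  · refine maxWelfare_le hX.nonempty fun S hS => ?_
    -- Every buyer is represented by her higher copy, except that `i` must use the copy which is not
    -- excluded.
    have hmem := image_copy_mem hS
      (Function.update (fun i => decide (z (i, false) ≤ z (i, true))) i (!β))
    refine le_trans (le_of_eq ?_)
      (le_maxWelfare (X := {T ∈ duplicateFeasible X | (i, β) ∉ T}) ⟨hmem, ?_⟩ z)
    · rw [Finset.sum_image (by simp)]
      refine Finset.sum_congr rfl fun j _ => ?_
      by_cases hj : j = i
      · subst hj
        simp
      · rw [Function.update_of_ne hj, Function.update_of_ne hj]
        by_cases h : z (j, false) ≤ z (j, true)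
        · simp [highValue, h]
        · simp [highValue, h, le_of_not_ge h]
    · simp only [Finset.mem_image, Prod.mk.injEq, not_exists, not_and]
      rintro j - rfl
      simp

/-- The VCG revenue with duplicates, which does not depend on how ties are broken: a buyer and
her duplicate together keep the welfare that would be lost by lowering the higher of their values
to the lower one. -/
theorem Mechanism.IsVCG.sum_pay {X : Set (Finset ι)} (hX : IsDownwardClosed X)
    {M : Mechanism (ι × Bool)} (hM : M.IsVCG (duplicateFeasible X)) (z : ι × Bool → ℝ) :
    ∑ b, M.pay z b = maxWelfare X (highValue z) - ∑ i, (maxWelfare X (highValue z) -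
      maxWelfare X (Function.update (highValue z) i (lowValue z i))) := by
  obtain ⟨S, hS, hmax, -, hpay⟩ := hM z
  have hW : ∑ b ∈ S, z b = maxWelfare X (highValue z) := by
    rw [← maxWelfare_duplicateFeasible hX.nonempty]
    exact le_antisymm (le_maxWelfare hS z) (maxWelfare_le ⟨S, hS⟩ hmax)
  have herase : ∀ b, ∑ j ∈ S.erase b, z j =
      maxWelfare X (highValue z) - if b ∈ S then z b else 0 := fun b => by
    split_ifs with hb
    · rw [← hW, ← Finset.sum_erase_add _ _ hb]
      ring
    · rw [Finset.erase_eq_of_notMem hb, hW, sub_zero]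
  have hb : ∀ b, M.pay z b = maxWelfare X (Function.update (highValue z) b.1 (z (b.1, !b.2))) -
      maxWelfare X (highValue z) + if b ∈ S then z b else 0 := fun b => by
    rw [hpay, maxWelfare_duplicateFeasible_without hX, herase]
    ring
  simp_rw [hb]
  rw [Finset.sum_add_distrib, Finset.sum_ite_mem, Finset.univ_inter, hW, Fintype.sum_prod_type,
    add_comm, sub_eq_add_neg, ← Finset.sum_neg_distrib]
  congr 1
  refine Finset.sum_congr rfl fun i _ => ?_
  have hself : maxWelfare X (Function.update (highValue z) i (highValue z i)) =
    maxWelfare X (highValue z) := by rw [Function.update_eq_self]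
  rw [Fintype.sum_bool]
  simp only [Bool.not_true, Bool.not_false]
  -- Removing the lower copy changes nothing; removing the higher one leaves the low value.
  rcases le_total (z (i, false)) (z (i, true)) with h | h
  · have h1 : z (i, true) = highValue z i := by simp [highValue, h]
    have h2 : z (i, false) = lowValue z i := by simp [lowValue, h]
    rw [h1, h2, hself]
    ring
  · have h1 : z (i, false) = highValue z i := by simp [highValue, h]
    have h2 : z (i, true) = lowValue z i := by simp [lowValue, h]
    rw [h1, h2, hself]
    ring

end Duplicates

/-! ### One buyer and her duplicate against a fixed threshold -/

section SinglePair

theorem measure_Ioi_eq_ofReal (μ : Measure ℝ) [IsProbabilityMeasure μ] (x : ℝ) :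
    μ (Set.Ioi x) = ENNReal.ofReal (1 - cdf μ x) := by
  rw [← Set.compl_Iic, prob_compl_eq_one_sub measurableSet_Iic, ← ofReal_cdf μ x,
    ENNReal.ofReal_sub _ (cdf_nonneg μ x), ENNReal.ofReal_one]

theorem IsValuation.ae_nonneg {μ : Measure ℝ} (h : IsValuation μ) : ∀ᵐ x ∂μ, 0 ≤ x := by
  rw [ae_iff]
  simp only [not_le]
  exact h.nonneg

/-- Quasi-MHR distributions: the smaller of two independent values stochastically dominates half
of a value. -/
theorem IsQuasiMHR.measure_Ioi_two_mul_le {μ : Measure ℝ} (h : IsQuasiMHR μ) {x : ℝ}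
    (hx : 0 < x) : μ (Set.Ioi (2 * x)) ≤ μ (Set.Ioi x) * μ (Set.Ioi x) := by
  have := h.isProbabilityMeasure
  have hle : cdf μ x ≤ cdf μ (2 * x) := monotone_cdf μ (by linarith)
  simp only [measure_Ioi_eq_ofReal]
  rw [← ENNReal.ofReal_mul (sub_nonneg.2 (cdf_le_one μ x))]
  rcases (cdf_le_one μ (2 * x)).lt_or_eq with h1 | h1
  · apply ENNReal.ofReal_le_ofReal
    -- Comparing the average hazard rate at `x` and `2x` gives `1 - F(2x) ≤ (1 - F x)²` in
    -- logarithmic form.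
    have hmono := h.monotoneOn (a := x) ⟨hx, hle.trans_lt h1⟩ (b := 2 * x) ⟨by linarith, h1⟩
      (by linarith)
    rw [avgHazardRate, avgHazardRate, div_le_div_iff₀ hx (by linarith)] at hmono
    have hlog : Real.log (1 - cdf μ (2 * x)) ≤ 2 * Real.log (1 - cdf μ x) := by
      nlinarith
    have hpos : 0 < 1 - cdf μ x := by linarith
    rw [← Real.log_le_log_iff (by linarith) (by positivity), Real.log_mul hpos.ne' hpos.ne']
    linarith
  · simp [h1]

theorem measure_prod_lt_min (μ : Measure ℝ) [SFinite μ] (s : ℝ) :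
    (μ.prod μ) {p | s < min p.1 p.2} = μ (Set.Ioi s) * μ (Set.Ioi s) := by
  rw [← Measure.prod_prod]
  congr 1
  ext p
  simp

/-- Exchanging the pair of the larger and the smaller of two values for the values themselves. -/
theorem lintegral_max_add_lintegral_min (μ : Measure ℝ) [IsProbabilityMeasure μ]
    (f : ℝ → ℝ≥0∞) (hf : Measurable f) :
    ∫⁻ p, f (max p.1 p.2) ∂(μ.prod μ) + ∫⁻ p, f (min p.1 p.2) ∂(μ.prod μ) =
      2 * ∫⁻ x, f x ∂μ := by
  have hfst : ∫⁻ p, f p.1 ∂(μ.prod μ) = ∫⁻ x, f x ∂μ :=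
    measurePreserving_fst.lintegral_comp hf
  have hsnd : ∫⁻ p, f p.2 ∂(μ.prod μ) = ∫⁻ x, f x ∂μ :=
    measurePreserving_snd.lintegral_comp hf
  rw [← lintegral_add_left (by fun_prop), two_mul]
  nth_rw 1 [← hfst]
  rw [← hsnd, ← lintegral_add_left (by fun_prop)]
  refine lintegral_congr fun p => ?_
  rcases le_total p.1 p.2 with h | h
  · simp [h, add_comm]
  · simp [h]

/-- The expected excess over `2 t` is at most twice the expected excess over `t` of the smaller
of two values. -/
theorem IsQuasiMHR.lintegral_sub_two_mul_le {μ : Measure ℝ} (h : IsQuasiMHR μ) {t : ℝ}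
    (ht : 0 ≤ t) : ∫⁻ x, ENNReal.ofReal (x - 2 * t) ∂μ ≤
      2 * ∫⁻ p, ENNReal.ofReal (min p.1 p.2 - t) ∂(μ.prod μ) := by
  have := h.isProbabilityMeasure
  -- Truncating at `0` makes both integrands nonnegative, so that the layer-cake formula reduces the
  -- claim to tails.
  have hl : ∫⁻ x, ENNReal.ofReal (x - 2 * t) ∂μ =
      2 * ∫⁻ x, ENNReal.ofReal (max (x / 2 - t) 0) ∂μ := by
    rw [← lintegral_const_mul _ (by fun_prop)]
    refine lintegral_congr fun x => ?_
    rw [ENNReal.ofReal_max, ENNReal.ofReal_zero, max_eq_left (zero_le),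
      show (2 : ℝ≥0∞) = ENNReal.ofReal 2 by simp, ← ENNReal.ofReal_mul (by norm_num)]
    congr 1
    ring
  have hr : ∫⁻ p, ENNReal.ofReal (min p.1 p.2 - t) ∂(μ.prod μ) =
      ∫⁻ p, ENNReal.ofReal (max (min p.1 p.2 - t) 0) ∂(μ.prod μ) := by
    simp [ENNReal.ofReal_max]
  rw [hl, hr, lintegral_eq_lintegral_meas_lt _ (f := fun x : ℝ => max (x / 2 - t) 0)
    (ae_of_all _ fun x => le_max_right _ _) (by fun_prop),
    lintegral_eq_lintegral_meas_lt _ (f := fun p : ℝ × ℝ => max (min p.1 p.2 - t) 0) (ae_of_all _ fun x => le_max_right _ _)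
    (by fun_prop)]
  gcongr 2 * ?_
  refine setLIntegral_mono' measurableSet_Ioi fun s hs => ?_
  rw [Set.mem_Ioi] at hs
  have h1 : {x : ℝ | s < max (x / 2 - t) 0} = Set.Ioi (2 * (t + s)) := by
    ext x
    simp only [Set.mem_ofPred_eq, lt_max_iff, hs.not_gt, or_false, Set.mem_Ioi]
    constructor <;> intro _ <;> linarith
  have h2 : {p : ℝ × ℝ | s < max (min p.1 p.2 - t) 0} = {p | t + s < min p.1 p.2} := by
    ext p
    simp only [Set.mem_ofPred_eq, lt_max_iff, hs.not_gt, or_false]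
    constructor <;> intro _ <;> linarith
  rw [h1, h2, measure_prod_lt_min]
  -- Only levels `s > 0` occur, so `t + s > 0` even for `t = 0`.
  exact h.measure_Ioi_two_mul_le (by linarith)

/-- For a buyer and her duplicate who face a threshold value `t`, the expected value of the
winner is at most three times her expected payment. -/
theorem IsQuasiMHR.lintegral_value_le {μ : Measure ℝ} (h : IsQuasiMHR μ) {t : ℝ} (ht : 0 ≤ t) :
    ∫⁻ p, ENNReal.ofReal (if t < max p.1 p.2 then max p.1 p.2 else 0) ∂(μ.prod μ) ≤
      3 * ∫⁻ p, ENNReal.ofReal (if t < max p.1 p.2 then max t (min p.1 p.2) else 0)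
        ∂(μ.prod μ) := by
  have := h.isProbabilityMeasure
  have hmt : MeasurableSet {p : ℝ × ℝ | t < max p.1 p.2} :=
    measurableSet_lt measurable_const (by fun_prop)
  set T := ∫⁻ p, ENNReal.ofReal (if t < max p.1 p.2 then t else 0) ∂(μ.prod μ) with hT
  set A := ∫⁻ p, ENNReal.ofReal (max p.1 p.2 - t) ∂(μ.prod μ) with hA
  set B := ∫⁻ p, ENNReal.ofReal (min p.1 p.2 - t) ∂(μ.prod μ) with hB
  have hTm : Measurable fun p : ℝ × ℝ => ENNReal.ofReal (if t < max p.1 p.2 then t else 0) :=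
    (Measurable.ite hmt measurable_const measurable_const).ennreal_ofReal
  have hl : ∫⁻ p, ENNReal.ofReal (if t < max p.1 p.2 then max p.1 p.2 else 0) ∂(μ.prod μ) =
      T + A := by
    rw [hT, hA, ← lintegral_add_left hTm]
    refine lintegral_congr fun p => ?_
    split_ifs with hp
    · rw [← ENNReal.ofReal_add ht (by linarith)]
      congr 1
      ring
    · rw [ENNReal.ofReal_of_nonpos (p := max p.1 p.2 - t) (by linarith)]
      simp
  have hr : ∫⁻ p, ENNReal.ofReal (if t < max p.1 p.2 then max t (min p.1 p.2) else 0)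
      ∂(μ.prod μ) = T + B := by
    rw [hT, hB, ← lintegral_add_left hTm]
    refine lintegral_congr fun p => ?_
    split_ifs with hp
    · rcases le_total t (min p.1 p.2) with h' | h'
      · rw [← ENNReal.ofReal_add ht (by linarith), max_eq_right h']
        congr 1
        ring
      · rw [max_eq_left h', ENNReal.ofReal_of_nonpos (p := min p.1 p.2 - t) (by linarith),
          add_zero]
    · have : min p.1 p.2 ≤ max p.1 p.2 := min_le_max
      rw [ENNReal.ofReal_of_nonpos (p := min p.1 p.2 - t) (by linarith)]
      simp
  rw [hl, hr]
  have hsum : A + B = 2 * ∫⁻ x, ENNReal.ofReal (x - t) ∂μ :=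
    lintegral_max_add_lintegral_min μ (fun x => ENNReal.ofReal (x - t)) (by fun_prop)
  -- A value above `t` exceeds it by at most `t` plus its excess over `2t`; moreover `v > t` is no
  -- more likely than `max > t`.
  have hsplit : ∫⁻ x, ENNReal.ofReal (x - t) ∂μ ≤
      T + ∫⁻ x, ENNReal.ofReal (x - 2 * t) ∂μ := by
    have hfst : T ≥ ∫⁻ x, ENNReal.ofReal (if t < x then t else 0) ∂μ := by
      rw [hT, ← (measurePreserving_fst (μ := μ) (ν := μ)).lintegral_comp
        (f := fun x => ENNReal.ofReal (if t < x then t else 0))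
        (Measurable.ite measurableSet_Ioi measurable_const measurable_const).ennreal_ofReal]
      refine lintegral_mono fun p => ENNReal.ofReal_le_ofReal ?_
      split_ifs with h1 h2
      · exact le_rfl
      · exact absurd (h1.trans_le (le_max_left _ _)) h2
      · exact ht
      · exact le_rfl
    refine le_trans ?_ (add_le_add_left hfst _)
    rw [← lintegral_add_right _ (by fun_prop)]
    refine lintegral_mono fun x => ?_
    split_ifs with hx
    · rcases le_total (x - 2 * t) 0 with h' | h'
      · exact (ENNReal.ofReal_le_ofReal (by linarith)).trans le_self_add
      · rw [← ENNReal.ofReal_add ht h']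
        exact ENNReal.ofReal_le_ofReal (by linarith)
    · rw [ENNReal.ofReal_of_nonpos (p := x - t) (by linarith)]
      exact zero_le
  have hAB : A + B ≤ 2 * T + 4 * B := by
    calc A + B ≤ 2 * (T + 2 * B) := by
          rw [hsum]
          gcongr
          exact hsplit.trans (by gcongr; exact h.lintegral_sub_two_mul_le ht)
      _ = 2 * T + 4 * B := by ring
  -- Cancelling `B` requires finiteness; for `B = ⊤` the right-hand side is infinite.
  rcases eq_or_ne B ⊤ with hB' | hB'
  · simp [hB', ENNReal.mul_top]
  · have hA' : A ≤ 2 * T + 3 * B := by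
      rw [← ENNReal.add_le_add_iff_right hB']
      exact hAB.trans (le_of_eq (by ring))
    calc T + A ≤ T + (2 * T + 3 * B) := by gcongr
      _ = 3 * (T + B) := by ring

end SinglePair

/-! ### The lower bound, buyer by buyer -/

section Guarantee

variable {ι : Type*} [Fintype ι] [DecidableEq ι]

/-- The value of buyer `i` if the welfare depends on her participation, and `0` otherwise. -/
def pivotalValue (X : Set (Finset ι)) (w : ι → ℝ) (i : ι) : ℝ :=
  if maxWelfare X (Function.update w i 0) < maxWelfare X w then w i else 0

/-- The payment of buyer `i` if the welfare depends on her participation and if she competes with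
a duplicate of value `x`. -/
def pivotalPay (X : Set (Finset ι)) (w : ι → ℝ) (i : ι) (x : ℝ) : ℝ :=
  pivotalValue X w i - (maxWelfare X w - maxWelfare X (Function.update w i x))

/-- Here `y` plays the higher and `x` the lower value of a pair. By `maxWelfare_update`, being
pivotal means exceeding the threshold `t`, and value minus lost welfare is then `max t x`. -/
theorem pivotal_update {X : Set (Finset ι)} (hX : IsDownwardClosed X) (w : ι → ℝ) (i : ι) :
    (∀ x y, pivotalValue X (Function.update w i y) i = 0 ∧
      pivotalPay X (Function.update w i y) i x = 0) ∨
    ∃ t, 0 ≤ t ∧ ∀ x y, x ≤ y →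
      pivotalValue X (Function.update w i y) i = (if t < y then y else 0) ∧
      pivotalPay X (Function.update w i y) i x = if t < y then max t x else 0 := by
  obtain ⟨a, h | ⟨t, ht, h⟩⟩ := maxWelfare_update hX i w
  · left
    simp [pivotalPay, pivotalValue, h]
  · right
    refine ⟨t, ht, fun x y hxy => ?_⟩
    have h0 : max a (a + 0 - t) = a := max_eq_left (by linarith)
    have hv : pivotalValue X (Function.update w i y) i = if t < y then y else 0 := by
      simp only [pivotalValue, Function.update_idem, Function.update_self, h, h0]
      congr 1
      rw [lt_max_iff, eq_iff_iff]
      simp only [lt_irrefl, false_or]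
      constructor <;> intro _ <;> linarith
    refine ⟨hv, ?_⟩
    simp only [pivotalPay, hv, Function.update_idem, h]
    split_ifs with hy
    · rw [max_eq_right (b := a + y - t) (by linarith)]
      rcases le_total t x with hx | hx
      · rw [max_eq_right hx, max_eq_right (by linarith)]
        ring
      · rw [max_eq_left hx, max_eq_left (by linarith)]
        ring
    · rw [max_eq_left (b := a + y - t) (by linarith), max_eq_left (by linarith)]
      ring

theorem pivotalPay_nonneg {X : Set (Finset ι)} (hX : IsDownwardClosed X) (w : ι → ℝ) (i : ι)
    {x : ℝ} (hx : x ≤ w i) : 0 ≤ pivotalPay X w i x := by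
  rcases pivotal_update hX w i with h | ⟨t, ht, h⟩
  · have := (h x (w i)).2
    rw [Function.update_eq_self] at this
    exact this.ge
  · have := (h x (w i) hx).2
    rw [Function.update_eq_self] at this
    rw [this]
    split_ifs
    · exact le_max_of_le_left ht
    · exact le_rfl

/-- A pivotal buyer belongs to every optimal set. The escape clause is needed because negative
values are excluded only almost surely. -/
theorem sum_pivotalValue_le {X : Set (Finset ι)} (hX : X.Nonempty) (w : ι → ℝ) :
    ∑ i, pivotalValue X w i ≤ maxWelfare X w ∨ ∃ i, w i < 0 := by
  by_cases hw : ∃ i, w i < 0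
  · exact Or.inr hw
  left
  push Not at hw
  obtain ⟨S, hS, h⟩ := exists_maxWelfare_eq hX w
  calc ∑ i, pivotalValue X w i ≤ ∑ i, if i ∈ S then w i else 0 := by
        refine Finset.sum_le_sum fun i _ => ?_
        rw [pivotalValue]
        split_ifs with h1 h2 h2
        · exact le_rfl
        · refine absurd h1 (not_lt.2 ?_)
          rw [h]
          refine le_trans (le_of_eq ?_) (le_maxWelfare hS _)
          exact Finset.sum_congr rfl fun j hj =>
            (Function.update_of_ne (ne_of_mem_of_not_mem hj h2) _ _).symm
        · exact hw i
        · exact le_rfl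
    _ = maxWelfare X w := by rw [h, Finset.sum_ite_mem, Finset.univ_inter]

theorem measurable_maxWelfare_update {α : Type*} [MeasurableSpace α] (X : Set (Finset ι)) (i : ι)
    {f : α → ι → ℝ} {g : α → ℝ} (hf : Measurable f) (hg : Measurable g) :
    Measurable fun z => maxWelfare X (Function.update (f z) i (g z)) :=
  (measurable_maxWelfare X).comp (measurable_update'.comp (hf.prodMk hg))

theorem measurable_pivotalValue (X : Set (Finset ι)) (i : ι) :
    Measurable fun z : ι × Bool → ℝ => pivotalValue X (highValue z) i :=
  Measurable.ite (measurableSet_lt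
    (measurable_maxWelfare_update X i measurable_highValue measurable_const)
    ((measurable_maxWelfare X).comp measurable_highValue))
    (measurable_pi_iff.1 measurable_highValue i) measurable_const

theorem measurable_pivotalPay (X : Set (Finset ι)) (i : ι) :
    Measurable fun z : ι × Bool → ℝ => pivotalPay X (highValue z) i (lowValue z i) :=
  (measurable_pivotalValue X i).sub
    (((measurable_maxWelfare X).comp measurable_highValue).sub
      (measurable_maxWelfare_update X i measurable_highValue
        (measurable_pi_iff.1 measurable_lowValue i)))

/-- It suffices to integrate over the two coordinates of pair `i` with all others fixed, so the
threshold is constant and `IsQuasiMHR.lintegral_value_le` applies. -/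
theorem IsQuasiMHR.lintegral_pivotalValue_le {X : Set (Finset ι)} (hX : IsDownwardClosed X)
    {F : ι → Measure ℝ} (hF : ∀ i, IsQuasiMHR (F i)) (i : ι) :
    ∫⁻ z, ENNReal.ofReal (pivotalValue X (highValue z) i) ∂(Measure.pi (duplicatePrior F)) ≤
      3 * ∫⁻ z, ENNReal.ofReal (pivotalPay X (highValue z) i (lowValue z i))
        ∂(Measure.pi (duplicatePrior F)) := by
  have hprob : ∀ b, IsProbabilityMeasure (duplicatePrior F b) :=
    fun b => (hF b.1).isProbabilityMeasure
  have := (hF i).isProbabilityMeasure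
  have hm1 := (measurable_pivotalValue X i).ennreal_ofReal
  have hm2 := (measurable_pivotalPay X i).ennreal_ofReal
  rw [← lintegral_const_mul _ hm2]
  refine lintegral_le_of_lmarginal_le {(i, false), (i, true)} hm1 (hm2.const_mul 3) fun z => ?_
  have hne : (i, false) ∉ ({(i, true)} : Finset (ι × Bool)) := by simp
  rw [lmarginal_insert _ hm1 hne, lmarginal_insert _ (hm2.const_mul 3) hne]
  simp only [lmarginal_singleton, highValue_update_update, lowValue_update_update]
  simp only [duplicatePrior]
  rcases pivotal_update hX (highValue z) i with h | ⟨t, ht, h⟩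
  · simp [fun y => (h 0 y).1]
  · simp only [fun x y : ℝ => (h (min x y) (max x y) min_le_max).1,
      fun x y : ℝ => (h (min x y) (max x y) min_le_max).2]
    have hmt : MeasurableSet {p : ℝ × ℝ | t < max p.1 p.2} :=
      measurableSet_lt measurable_const (by fun_prop)
    have hg1 : Measurable fun p : ℝ × ℝ =>
        ENNReal.ofReal (if t < max p.1 p.2 then max p.1 p.2 else 0) :=
      (Measurable.ite hmt (by fun_prop) measurable_const).ennreal_ofReal
    have hg2 : Measurable fun p : ℝ × ℝ =>
        ENNReal.ofReal (if t < max p.1 p.2 then max t (min p.1 p.2) else 0) :=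
      (Measurable.ite hmt (by fun_prop) measurable_const).ennreal_ofReal
    have hkey := (hF i).lintegral_value_le ht
    rw [← lintegral_const_mul _ hg2, lintegral_prod _ hg1.aemeasurable,
      lintegral_prod _ (hg2.const_mul 3).aemeasurable] at hkey
    exact hkey

theorem ae_pi_nonneg {κ : Type*} [Fintype κ] {G : κ → Measure ℝ} (hG : ∀ b, IsValuation (G b)) :
    ∀ᵐ z ∂(Measure.pi G), ∀ b, 0 ≤ z b := by
  have := fun b => (hG b).isProbabilityMeasure
  exact ae_all_iff.2 fun b =>
    (measurePreserving_eval G b).quasiMeasurePreserving.ae (hG b).ae_nonneg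

/-- The VCG auction with duplicates earns at least a third of the welfare with duplicates. -/
theorem lintegral_maxWelfare_highValue_le {X : Set (Finset ι)} (hX : IsDownwardClosed X)
    {F : ι → Measure ℝ} (hF : ∀ i, IsQuasiMHR (F i)) {M : Mechanism (ι × Bool)}
    (hM : M.IsVCG (duplicateFeasible X)) :
    ∫⁻ z, ENNReal.ofReal (maxWelfare X (highValue z)) ∂(Measure.pi (duplicatePrior F)) ≤
      3 * M.revenue (duplicatePrior F) := by
  set P := Measure.pi (duplicatePrior F)
  -- The welfare left after the pivotal values appears unchanged in both welfare and revenue, so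
  -- losing a factor `3` on it is harmless.
  set r : (ι × Bool → ℝ) → ℝ := fun z =>
    maxWelfare X (highValue z) - ∑ i, pivotalValue X (highValue z) i with hr
  have hae : ∀ᵐ z ∂P, 0 ≤ r z ∧ ∀ i, 0 ≤ pivotalValue X (highValue z) i := by
    filter_upwards [ae_pi_nonneg (G := duplicatePrior F) fun b => (hF b.1).toIsValuation]
      with z hz
    have hw : ∀ i, 0 ≤ highValue z i := fun i => (hz (i, false)).trans (le_max_left _ _)
    refine ⟨sub_nonneg.2 ((sum_pivotalValue_le hX.nonempty _).resolve_right ?_), fun i => ?_⟩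
    · push Not
      exact hw
    · rw [pivotalValue]
      split_ifs
      · exact hw i
      · exact le_rfl
  have hl : ∫⁻ z, ENNReal.ofReal (maxWelfare X (highValue z)) ∂P = ∫⁻ z, ENNReal.ofReal (r z) ∂P +
      ∑ i, ∫⁻ z, ENNReal.ofReal (pivotalValue X (highValue z) i) ∂P := by
    rw [← lintegral_finsetSum _ fun i _ => (measurable_pivotalValue X i).ennreal_ofReal,
      ← lintegral_add_right _
        (Finset.measurable_sum _ fun i _ => (measurable_pivotalValue X i).ennreal_ofReal)]
    refine lintegral_congr_ae ?_
    filter_upwards [hae] with z hz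
    rw [← ENNReal.ofReal_sum_of_nonneg fun i _ => hz.2 i,
      ← ENNReal.ofReal_add hz.1 (Finset.sum_nonneg fun i _ => hz.2 i), hr]
    congr 1
    ring
  have hrev : M.revenue (duplicatePrior F) = ∫⁻ z, ENNReal.ofReal (r z) ∂P +
      ∑ i, ∫⁻ z, ENNReal.ofReal (pivotalPay X (highValue z) i (lowValue z i)) ∂P := by
    rw [← lintegral_finsetSum _ fun i _ => (measurable_pivotalPay X i).ennreal_ofReal,
      ← lintegral_add_right _
        (Finset.measurable_sum _ fun i _ => (measurable_pivotalPay X i).ennreal_ofReal)]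
    refine lintegral_congr_ae ?_
    filter_upwards [hae] with z hz
    have hp : ∀ i ∈ Finset.univ, 0 ≤ pivotalPay X (highValue z) i (lowValue z i) :=
      fun i _ => pivotalPay_nonneg hX _ i (lowValue_le_highValue z i)
    rw [← ENNReal.ofReal_sum_of_nonneg hp,
      ← ENNReal.ofReal_add hz.1 (Finset.sum_nonneg hp), hM.sum_pay hX, hr]
    simp only [pivotalPay, Finset.sum_sub_distrib]
    congr 1
    ring
  rw [hl, hrev, mul_add, Finset.mul_sum]
  refine add_le_add ?_ (Finset.sum_le_sum fun i _ => IsQuasiMHR.lintegral_pivotalValue_le hX hF i)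
  exact le_mul_of_one_le_left' (by norm_num)

theorem vcgGuarantee_optimalWelfare :
    VCGGuarantee IsQuasiMHR (fun _ X F => optimalWelfare X F) (1 / 3) := by
  intro n X F M hX hF hM
  calc 1 / 3 * optimalWelfare X F ≤ 1 / 3 * (3 * M.revenue (duplicatePrior F)) := by
        gcongr
        exact (optimalWelfare_le hX.nonempty fun i => (hF i).isProbabilityMeasure).trans
          (lintegral_maxWelfare_highValue_le hX hF hM)
    _ = M.revenue (duplicatePrior F) := by
        rw [← mul_assoc, one_div, ENNReal.inv_mul_cancel (by norm_num) (by norm_num), one_mul]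

end Guarantee

/-! ### Optimal revenue is at most optimal welfare -/

section Benchmarks

variable {ι : Type*} [DecidableEq ι]

theorem mem_Icc_of_mem_convexHull {X : Set (Finset ι)} {a : ι → ℝ}
    (ha : a ∈ convexHull ℝ (allocationOf '' X)) : a ∈ Set.Icc (0 : ι → ℝ) 1 := by
  refine convexHull_min ?_ (convex_Icc 0 1) ha
  rintro _ ⟨S, -, rfl⟩
  constructor <;> intro i <;> simp only [allocationOf] <;> split_ifs <;> simp

variable [Fintype ι]

theorem sum_mul_le_maxWelfare {X : Set (Finset ι)} {a : ι → ℝ}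
    (ha : a ∈ convexHull ℝ (allocationOf '' X)) (v : ι → ℝ) :
    ∑ i, v i * a i ≤ maxWelfare X v := by
  have hlin : IsLinearMap ℝ fun b : ι → ℝ => ∑ i, v i * b i :=
    ⟨fun b c => by simp [mul_add, Finset.sum_add_distrib],
      fun r b => by simp [Finset.mul_sum, mul_left_comm]⟩
  refine convexHull_min ?_ (convex_halfSpace_le hlin (maxWelfare X v)) ha
  rintro _ ⟨S, hS, rfl⟩
  refine le_trans (le_of_eq ?_) (le_maxWelfare hS v)
  simp [allocationOf]

/-- Resampling a single coordinate does not change an expectation. -/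
theorem lintegral_pi_update {F : ι → Measure ℝ} [∀ i, IsProbabilityMeasure (F i)]
    {f : (ι → ℝ) → ℝ≥0∞} (hf : Measurable f) (i : ι) :
    ∫⁻ s, ∫⁻ v, f (Function.update v i s) ∂(Measure.pi F) ∂(F i) = ∫⁻ v, f v ∂(Measure.pi F) := by
  have hm : Measurable fun p : ℝ × (ι → ℝ) => f (Function.update p.2 i p.1) :=
    hf.comp (measurable_update'.comp (measurable_snd.prodMk measurable_fst))
  rw [lintegral_lintegral_swap hm.aemeasurable]
  refine lintegral_eq_of_lmarginal_eq {i}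
    (hm.comp measurable_swap).lintegral_prod_right' hf ?_
  simp [lmarginal_singleton]

/-- Resampling coordinate `i` turns both sides into averages of interim quantities over her report
`s`. Individual rationality compares these for `s` in the support, hence for almost every `s`. -/
theorem Mechanism.IsAdmissible.lintegral_pay_le {M : Mechanism ι} {X : Set (Finset ι)}
    {F : ι → Measure ℝ} (hM : M.IsAdmissible X F) (hF : ∀ i, IsValuation (F i)) (i : ι) :
    ∫⁻ v, ENNReal.ofReal (M.pay v i) ∂(Measure.pi F) ≤
      ∫⁻ v, ENNReal.ofReal (v i * M.alloc v i) ∂(Measure.pi F) := by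
  have := fun j => (hF j).isProbabilityMeasure
  have ha : Measurable fun v => M.alloc v i := measurable_pi_iff.1 hM.measurable_alloc i
  have hp : Measurable fun v => M.pay v i := measurable_pi_iff.1 hM.measurable_pay i
  have hva : Measurable fun v => v i * M.alloc v i := (measurable_pi_apply i).mul ha
  have hIcc := fun v => mem_Icc_of_mem_convexHull (hM.feasible v)
  rw [← lintegral_pi_update hp.ennreal_ofReal i,
    ← lintegral_pi_update hva.ennreal_ofReal i]
  refine lintegral_mono_ae ?_
  filter_upwards [(F i).support_mem_ae, (hF i).ae_nonneg] with s hs hs0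
  have hint : Integrable (fun v => M.alloc (Function.update v i s) i) (Measure.pi F) := by
    refine Integrable.of_bound (C := 1)
      (ha.comp (measurable_update_left)).aestronglyMeasurable (ae_of_all _ fun v => ?_)
    rw [Real.norm_of_nonneg ((hIcc _).1 i)]
    exact (hIcc _).2 i
  simp only [Function.update_self]
  rw [← ofReal_integral_eq_lintegral_ofReal (hM.integrable_pay i s hs)
      (ae_of_all _ fun v => hM.pay_nonneg _ i),
    ← ofReal_integral_eq_lintegral_ofReal (hint.const_mul s)
      (ae_of_all _ fun v => mul_nonneg hs0 ((hIcc _).1 i)), integral_const_mul]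
  exact ENNReal.ofReal_le_ofReal (sub_nonneg.1 (hM.individually_rational i s hs))

theorem optimalRevenue_le_optimalWelfare {X : Set (Finset ι)} {F : ι → Measure ℝ}
    (hF : ∀ i, IsValuation (F i)) : optimalRevenue X F ≤ optimalWelfare X F := by
  have := fun j => (hF j).isProbabilityMeasure
  refine iSup₂_le fun M hM => ?_
  have ha : ∀ i, Measurable fun v => M.alloc v i := measurable_pi_iff.1 hM.measurable_alloc
  have hp : ∀ i, Measurable fun v => M.pay v i := measurable_pi_iff.1 hM.measurable_pay
  calc M.revenue F = ∑ i, ∫⁻ v, ENNReal.ofReal (M.pay v i) ∂(Measure.pi F) := by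
        rw [← lintegral_finsetSum _ fun i _ => (hp i).ennreal_ofReal, Mechanism.revenue]
        exact lintegral_congr fun v => ENNReal.ofReal_sum_of_nonneg fun i _ => hM.pay_nonneg v i
    _ ≤ ∑ i, ∫⁻ v, ENNReal.ofReal (v i * M.alloc v i) ∂(Measure.pi F) :=
        Finset.sum_le_sum fun i _ => hM.lintegral_pay_le hF i
    _ = ∫⁻ v, ∑ i, ENNReal.ofReal (v i * M.alloc v i) ∂(Measure.pi F) :=
        (lintegral_finsetSum _ fun i _ =>
          ((measurable_pi_apply i).mul (ha i)).ennreal_ofReal).symm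
    _ ≤ optimalWelfare X F := by
        refine lintegral_mono_ae ?_
        filter_upwards [ae_pi_nonneg hF] with v hv
        rw [← ENNReal.ofReal_sum_of_nonneg fun i _ =>
          mul_nonneg (hv i) ((mem_Icc_of_mem_convexHull (hM.feasible v)).1 i)]
        exact ENNReal.ofReal_le_ofReal (sum_mul_le_maxWelfare (hM.feasible v) v)

theorem VCGGuarantee.of_le {P Q : Measure ℝ → Prop} (hPQ : ∀ μ, Q μ → P μ)
    {B C : (n : ℕ) → Set (Finset (Fin n)) → (Fin n → Measure ℝ) → ℝ≥0∞}
    (hBC : ∀ n X F, (∀ i, Q (F i)) → C n X F ≤ B n X F) {c : ℝ≥0∞} (h : VCGGuarantee P B c) :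
    VCGGuarantee Q C c := fun n X F M hX hF hM =>
  (mul_le_mul_right (hBC n X F hF) c).trans (h n X F M hX (fun i => hPQ _ (hF i)) hM)

end Benchmarks

/-! ### MHR distributions -/

section HazardRate

/-- After rescaling to `[0, 1]`, the average hazard rate is `∫₀¹ h (v s) ds`, whose integrand is
increasing in `v`. -/
theorem IsMHR.isQuasiMHR {μ : Measure ℝ} (hμ : IsMHR μ) : IsQuasiMHR μ := by
  refine ⟨hμ.toIsValuation, ?_⟩
  obtain ⟨h, hmono, -, hexp⟩ := hμ.exists_hazardRate
  have hsub : ∀ v, cdf μ v < 1 → Set.Icc 0 v ⊆ {u | 0 ≤ u ∧ cdf μ u < 1} := fun v hv u hu =>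
    ⟨hu.1, (monotone_cdf μ hu.2).trans_lt hv⟩
  have hint : ∀ v, 0 ≤ v → cdf μ v < 1 → IntervalIntegrable h volume 0 v := fun v hv hv1 => by
    refine MonotoneOn.intervalIntegrable ?_
    rw [Set.uIcc_of_le hv]
    exact hmono.mono (hsub v hv1)
  have havg : ∀ v, 0 < v → cdf μ v < 1 →
      avgHazardRate μ v = ∫ s in (0 : ℝ)..1, h (v * s) := fun v hv hv1 => by
    rw [avgHazardRate, hexp v hv.le hv1, Real.log_exp, neg_neg,
      intervalIntegral.integral_comp_mul_left _ hv.ne', mul_zero, mul_one, smul_eq_mul,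
      div_eq_inv_mul]
  have hint' : ∀ v, 0 < v → cdf μ v < 1 →
      IntervalIntegrable (fun s => h (v * s)) volume 0 1 := fun v hv hv1 => by
    have := (hint v hv.le hv1).comp_mul_left (c := v)
    rwa [zero_div, div_self hv.ne'] at this
  rintro u ⟨hu, hu1⟩ v ⟨hv, hv1⟩ huv
  rw [havg u hu hu1, havg v hv hv1]
  refine intervalIntegral.integral_mono_on zero_le_one (hint' u hu hu1) (hint' v hv hv1) ?_
  intro s hs
  exact hmono
    (hsub u hu1 ⟨mul_nonneg hu.le hs.1, mul_le_of_le_one_right hu.le hs.2⟩)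
    (hsub v hv1 ⟨mul_nonneg hv.le hs.1, mul_le_of_le_one_right hv.le hs.2⟩)
    (mul_le_mul_of_nonneg_right huv hs.1)

/-- Hazard rate `0` below the atom, which sits at the supremum of the support. -/
theorem isMHR_dirac {a : ℝ} (ha : 0 ≤ a) : IsMHR (Measure.dirac a) := by
  have hcdf : ∀ v, cdf (Measure.dirac a) v < 1 → cdf (Measure.dirac a) v = 0 := fun v hv => by
    rw [cdf_eq_real, Measure.real, Measure.dirac_apply' _ measurableSet_Iic] at hv ⊢
    by_cases h : a ∈ Set.Iic v
    · simp [h] at hv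
    · simp [h]
  refine ⟨⟨inferInstance, ?_⟩, fun _ => 0, monotoneOn_const, fun _ _ _ => le_rfl, ?_⟩
  · rw [Measure.dirac_apply' _ measurableSet_Iio]
    simp [ha]
  · intro v _ hv
    simp [hcdf v hv]

theorem isMHR_expMeasure : IsMHR (expMeasure 1) := by
  have := isProbabilityMeasure_expMeasure one_pos
  have hcdf : ∀ v, 0 ≤ v → 1 - cdf (expMeasure 1) v = Real.exp (-v) := fun v hv => by
    rw [cdf_expMeasure_eq one_pos, if_pos hv]
    ring_nf
  refine ⟨⟨this, ?_⟩, fun _ => 1, monotoneOn_const, fun _ _ _ => zero_le_one, ?_⟩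
  · refine measure_mono_null Set.Iio_subset_Iic_self ?_
    rw [← ofReal_cdf, cdf_expMeasure_eq one_pos]
    simp
  · intro v hv _
    rw [hcdf v hv]
    simp

end HazardRate

/-! ### Existence of VCG auctions and posting a known value -/

section Mechanisms

variable {ι : Type*} [Fintype ι] [DecidableEq ι]

theorem exists_isVCG {X : Set (Finset ι)} (hX : X.Nonempty) : ∃ M : Mechanism ι, M.IsVCG X := by
  choose S hS h using fun v => exists_maxWelfare_eq hX v
  exact ⟨⟨fun v => allocationOf (S v),
    fun v i => maxWelfare {T ∈ X | i ∉ T} v - ∑ j ∈ (S v).erase i, v j⟩,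
    fun v => ⟨S v, hS v, fun T hT => h v ▸ le_maxWelfare hT v, rfl, fun _ => rfl⟩⟩

theorem eq_of_mem_support_dirac {a s : ℝ} (hs : s ∈ (Measure.dirac a).support) : s = a :=
  Measure.support_subset_of_isClosed (t := {a}) isClosed_singleton
    (by simp) hs

/-- A buyer with a deterministic value can be charged this value. -/
theorem le_optimalRevenue_of_dirac {X : Set (Finset ι)} {F : ι → Measure ℝ}
    (hF : ∀ i, IsProbabilityMeasure (F i)) {i : ι} (hi : {i} ∈ X) {a : ℝ} (ha : 0 ≤ a)
    (hFi : F i = Measure.dirac a) : ENNReal.ofReal a ≤ optimalRevenue X F := by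
  set M : Mechanism ι := ⟨fun _ => allocationOf {i}, fun _ => Pi.single i a⟩ with hM
  have hadm : M.IsAdmissible X F :=
    { measurable_alloc := measurable_const
      measurable_pay := measurable_const
      feasible := fun _ => subset_convexHull ℝ _ ⟨{i}, hi, rfl⟩
      pay_nonneg := fun _ j => by
        rcases eq_or_ne j i with rfl | hj
        · simpa [hM] using ha
        · simp [hM, hj]
      integrable_pay := fun _ _ _ => integrable_const _
      incentive_compatible := fun j s _ s' _ => by
        simp [Mechanism.interimAlloc, Mechanism.interimPay, hM]
      individually_rational := fun j s hs => by
        rcases eq_or_ne j i with rfl | hj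
        · rw [hFi] at hs
          simp [Mechanism.interimAlloc, Mechanism.interimPay, hM, allocationOf,
            eq_of_mem_support_dirac hs]
        · simp [Mechanism.interimAlloc, Mechanism.interimPay, hM, allocationOf, hj] }
  refine le_trans (le_of_eq ?_) (le_iSup₂_of_le M hadm le_rfl)
  simp [Mechanism.revenue, hM]

end Mechanisms

/-! ### Maximum and minimum of two standard exponentials -/

section Exponential

theorem lintegral_exp_neg_mul {c : ℝ} (hc : 0 < c) :
    ∫⁻ s in Set.Ioi (0 : ℝ), ENNReal.ofReal (Real.exp (-c * s)) = ENNReal.ofReal (1 / c) := by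
  rw [← ofReal_integral_eq_lintegral_ofReal (exp_neg_integrableOn_Ioi 0 hc)
    (ae_of_all _ fun s => (Real.exp_pos _).le), integral_exp_mul_Ioi (by linarith)]
  simp

theorem expMeasure_Ioi {s : ℝ} (hs : 0 ≤ s) :
    expMeasure 1 (Set.Ioi s) = ENNReal.ofReal (Real.exp (-s)) := by
  have := isProbabilityMeasure_expMeasure one_pos
  rw [measure_Ioi_eq_ofReal, cdf_expMeasure_eq one_pos, if_pos hs]
  ring_nf

theorem lintegral_id_expMeasure : ∫⁻ x, ENNReal.ofReal x ∂(expMeasure 1) = 1 := by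
  rw [lintegral_eq_lintegral_meas_lt (f := fun x : ℝ => x) _
    isMHR_expMeasure.toIsValuation.ae_nonneg aemeasurable_id]
  have : ∫⁻ s in Set.Ioi (0 : ℝ), expMeasure 1 {x | s < x} =
      ∫⁻ s in Set.Ioi (0 : ℝ), ENNReal.ofReal (Real.exp (-1 * s)) :=
    setLIntegral_congr_fun measurableSet_Ioi fun s hs => by
      rw [neg_one_mul]
      exact expMeasure_Ioi hs.le
  rw [this, lintegral_exp_neg_mul one_pos]
  simp

theorem ae_prod_nonneg {μ : Measure ℝ} (h : IsValuation μ) :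
    ∀ᵐ p ∂(μ.prod μ), 0 ≤ p.1 ∧ 0 ≤ p.2 := by
  have := h.isProbabilityMeasure
  exact ((measurePreserving_fst (μ := μ) (ν := μ)).quasiMeasurePreserving.ae h.ae_nonneg).and
    ((measurePreserving_snd (μ := μ) (ν := μ)).quasiMeasurePreserving.ae h.ae_nonneg)

theorem lintegral_min_expMeasure :
    ∫⁻ p, ENNReal.ofReal (min p.1 p.2) ∂((expMeasure 1).prod (expMeasure 1)) =
      ENNReal.ofReal (1 / 2) := by
  have := isProbabilityMeasure_expMeasure one_pos
  rw [lintegral_eq_lintegral_meas_lt (f := fun p : ℝ × ℝ => min p.1 p.2) _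
    ((ae_prod_nonneg isMHR_expMeasure.toIsValuation).mono fun p hp => le_min hp.1 hp.2)
    (by fun_prop), ← lintegral_exp_neg_mul two_pos]
  refine setLIntegral_congr_fun measurableSet_Ioi fun s hs => ?_
  rw [measure_prod_lt_min, expMeasure_Ioi hs.le, ← ENNReal.ofReal_mul (Real.exp_pos _).le,
    ← Real.exp_add]
  ring_nf

theorem lintegral_max_expMeasure :
    ∫⁻ p, ENNReal.ofReal (max p.1 p.2) ∂((expMeasure 1).prod (expMeasure 1)) =
      ENNReal.ofReal (3 / 2) := by
  have := isProbabilityMeasure_expMeasure one_pos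
  have h := lintegral_max_add_lintegral_min (expMeasure 1) ENNReal.ofReal
    ENNReal.measurable_ofReal
  rw [lintegral_min_expMeasure, lintegral_id_expMeasure] at h
  rw [← ENNReal.add_left_inj (a := ENNReal.ofReal (1 / 2)) ENNReal.ofReal_ne_top, h,
    ← ENNReal.ofReal_add (by norm_num) (by norm_num)]
  norm_num

theorem memLp_id_expMeasure : MemLp (fun x : ℝ => x) 2 (expMeasure 1) := by
  rw [memLp_two_iff_integrable_sq (f := fun x : ℝ => x) (by fun_prop), expMeasure, gammaMeasure,
    integrable_withDensity_iff (f := gammaPDF 1 1)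
      (measurable_gammaPDFReal 1 1).ennreal_ofReal (ae_of_all _ fun _ => ENNReal.ofReal_lt_top)]
  -- `x² e⁻ˣ`, the second-moment integrand, is the integrand of `Γ(3)`.
  have hG := Real.GammaIntegral_convergent (s := 3) (by norm_num)
  rw [← integrableOn_Ici_iff_integrableOn_Ioi, ← integrable_indicator_iff measurableSet_Ici] at hG
  refine hG.congr (ae_of_all _ fun x => ?_)
  beta_reduce
  by_cases hx : 0 ≤ x
  · rw [Set.indicator_of_mem (Set.mem_Ici.2 hx), gammaPDF_of_nonneg hx,
      ENNReal.toReal_ofReal (by positivity)]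
    norm_num
    ring
  · rw [Set.indicator_of_notMem (by simpa using hx), gammaPDF_of_neg (not_le.1 hx)]
    simp

theorem memLp_max_expMeasure :
    MemLp (fun p : ℝ × ℝ => max p.1 p.2) 2 ((expMeasure 1).prod (expMeasure 1)) := by
  have := isProbabilityMeasure_expMeasure one_pos
  exact (memLp_id_expMeasure.comp_measurePreserving measurePreserving_fst).sup
    (memLp_id_expMeasure.comp_measurePreserving measurePreserving_snd)

theorem integral_max_expMeasure :
    ∫ p, max p.1 p.2 ∂((expMeasure 1).prod (expMeasure 1)) = 3 / 2 := by
  rw [integral_eq_lintegral_of_nonneg_ae ((ae_prod_nonneg isMHR_expMeasure.toIsValuation).mono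
    fun p hp => le_max_of_le_left hp.1) (by fun_prop), lintegral_max_expMeasure,
    ENNReal.toReal_ofReal (by norm_num)]

end Exponential

/-! ### The tight instance, pointwise -/

section Tightness

/-- Either buyer `0` wins alone, or any set of the other `k` buyers wins. -/
def oneOrOthers (k : ℕ) : Set (Finset (Fin (k + 1))) := {S | 0 ∈ S → S = {0}}

theorem isDownwardClosed_oneOrOthers (k : ℕ) : IsDownwardClosed (oneOrOthers k) := by
  refine ⟨⟨∅, by simp [oneOrOthers]⟩, fun S T hTS hS h0 => ?_⟩
  have h := hS (hTS h0)
  subst h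
  exact (Finset.subset_singleton_iff.1 hTS).resolve_left (Finset.ne_empty_of_mem h0)

theorem singleton_zero_mem_oneOrOthers (k : ℕ) : {0} ∈ oneOrOthers k := fun _ => rfl

theorem maxWelfare_oneOrOthers {k : ℕ} {w : Fin (k + 1) → ℝ} (hw : ∀ i, 0 ≤ w i) :
    maxWelfare (oneOrOthers k) w = max (w 0) (∑ i : Fin k, w i.succ) := by
  apply le_antisymm
  · refine maxWelfare_le (isDownwardClosed_oneOrOthers k).nonempty fun S hS => ?_
    by_cases h0 : 0 ∈ S
    · simp [hS h0]
    · refine le_max_of_le_right ?_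
      rw [← Finset.univ_inter S, ← Finset.sum_ite_mem, Fin.sum_univ_succ, if_neg h0, zero_add]
      refine Finset.sum_le_sum fun i _ => ?_
      split_ifs
      · exact le_rfl
      · exact hw _
  · refine max_le ?_ ?_
    · refine le_trans (le_of_eq ?_) (le_maxWelfare (singleton_zero_mem_oneOrOthers k) w)
      simp
    · refine le_trans (le_of_eq ?_) (le_maxWelfare (S := Finset.univ.map (Fin.succEmb k)) ?_ w)
      · simp
      · intro h
        simp at h

/-- If buyer `0` and her duplicate have the value `a` and the other winners have welfare at least
`a + d`, these pay hardly more than the values of their duplicates. -/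
theorem sum_pay_oneOrOthers_le {k : ℕ} {w l : Fin (k + 1) → ℝ} {a d : ℝ} (hd : 0 < d)
    (hl : ∀ i, 0 ≤ l i) (hlw : ∀ i, l i ≤ w i) (hw0 : w 0 = a) (hl0 : l 0 = a) :
    maxWelfare (oneOrOthers k) w - ∑ i, (maxWelfare (oneOrOthers k) w -
      maxWelfare (oneOrOthers k) (Function.update w i (l i))) ≤
    ∑ i : Fin k, l i.succ + ∑ i : Fin k, w i.succ ^ 2 / (4 * d) +
      if ∑ i : Fin k, w i.succ < a + d then a + d else 0 := by
  have hw : ∀ i, 0 ≤ w i := fun i => (hl i).trans (hlw i)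
  set W := maxWelfare (oneOrOthers k)
  have hmono : ∀ i, W (Function.update w i (l i)) ≤ W w := fun i =>
    maxWelfare_mono (isDownwardClosed_oneOrOthers k).nonempty (update_le_self_iff.2 (hlw i))
  have hWw : W w = max a (∑ i : Fin k, w i.succ) := by
    rw [← hw0]
    exact maxWelfare_oneOrOthers hw
  have hl' : 0 ≤ ∑ i : Fin k, l i.succ := Finset.sum_nonneg fun i _ => hl _
  have hw' : 0 ≤ ∑ i : Fin k, w i.succ ^ 2 / (4 * d) :=
    Finset.sum_nonneg fun i _ => by positivity
  -- When the others fall short of `a + d`, revenue is bounded by the welfare, which is at most `a +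
  -- d`.
  split_ifs with hs
  · have h1 : 0 ≤ ∑ i, (W w - W (Function.update w i (l i))) :=
      Finset.sum_nonneg fun i _ => sub_nonneg.2 (hmono i)
    have h2 : W w ≤ a + d := hWw ▸ max_le (by linarith) hs.le
    linarith
  · have hs' : W w = ∑ i : Fin k, w i.succ := by
      rw [hWw, max_eq_right (by linarith)]
    have h0 : Function.update w 0 (l 0) = w := by rw [hl0, ← hw0, Function.update_eq_self]
    -- Lowering `i` loses the smaller of her gap `w - l` and the margin over `a`, which is at least
    -- `d`. The quadratic term absorbs the case where the margin binds.
    have hterm : ∀ i : Fin k, w i.succ - l i.succ - w i.succ ^ 2 / (4 * d) ≤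
        W w - W (Function.update w i.succ (l i.succ)) := fun i => by
      -- This is `(2d - w)² ≥ 0`.
      have hq : w i.succ - w i.succ ^ 2 / (4 * d) ≤ d := by
        rw [sub_le_iff_le_add, ← sub_le_iff_le_add', le_div_iff₀ (by positivity)]
        nlinarith [sq_nonneg (2 * d - w i.succ)]
      have hnn : ∀ j, 0 ≤ Function.update w i.succ (l i.succ) j := fun j => by
        rcases eq_or_ne j i.succ with rfl | hj
        · simpa using hl _
        · simpa [hj] using hw j
      have hsum : ∑ j : Fin k, Function.update w i.succ (l i.succ) j.succ =
          ∑ j : Fin k, w j.succ - w i.succ + l i.succ := by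
        rw [← Finset.sum_erase_add _ _ (Finset.mem_univ i),
          ← Finset.sum_erase_add _ (fun j : Fin k => w j.succ) (Finset.mem_univ i),
          Function.update_self, Finset.sum_congr rfl fun j hj => Function.update_of_ne
            ((Fin.succ_injective k).ne (Finset.ne_of_mem_erase hj)) _ _]
        ring
      have hsq : 0 ≤ w i.succ ^ 2 / (4 * d) := by positivity
      rw [show W (Function.update w i.succ (l i.succ)) = _ from maxWelfare_oneOrOthers hnn, hsum,
        Function.update_of_ne (Fin.succ_ne_zero i).symm, hw0, hs', le_sub_comm]
      refine max_le ?_ ?_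
      · linarith [hl i.succ]
      · linarith
    have hsum := Finset.sum_le_sum fun (i : Fin k) (_ : i ∈ Finset.univ) => hterm i
    rw [Finset.sum_sub_distrib, Finset.sum_sub_distrib] at hsum
    rw [Fin.sum_univ_succ, h0, sub_self, zero_add, add_zero]
    linarith

end Tightness

/-! ### The tight instance in expectation -/

section TightnessInExpectation

theorem measurePreserving_pair {ι : Type*} [Fintype ι] {F : ι → Measure ℝ}
    (hF : ∀ i, IsProbabilityMeasure (F i)) (i : ι) :
    MeasurePreserving (fun z : ι × Bool → ℝ => (z (i, false), z (i, true)))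
      (Measure.pi (duplicatePrior F)) ((F i).prod (F i)) := by
  have hprob : ∀ b, IsProbabilityMeasure (duplicatePrior F b) := fun b => hF b.1
  have hind : iIndepFun (fun (b : ι × Bool) (z : ι × Bool → ℝ) => z b)
      (Measure.pi (duplicatePrior F)) := iIndepFun_pi (X := fun _ x => x) fun _ => aemeasurable_id
  refine ⟨by fun_prop, ?_⟩
  rw [(indepFun_iff_map_prod_eq_prod_map_map (measurable_pi_apply _).aemeasurable
    (measurable_pi_apply _).aemeasurable).1
    (hind.indepFun (i := (i, false)) (j := (i, true)) (by simp)),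
    (measurePreserving_eval (duplicatePrior F) (i, false)).map_eq,
    (measurePreserving_eval (duplicatePrior F) (i, true)).map_eq]
  rfl

theorem indepFun_highValue {ι : Type*} [Fintype ι] {F : ι → Measure ℝ}
    (hF : ∀ i, IsProbabilityMeasure (F i)) {i j : ι} (hij : i ≠ j) :
    IndepFun (fun z : ι × Bool → ℝ => highValue z i) (fun z => highValue z j)
      (Measure.pi (duplicatePrior F)) := by
  have hprob : ∀ b, IsProbabilityMeasure (duplicatePrior F b) := fun b => hF b.1
  have hind : iIndepFun (fun (b : ι × Bool) (z : ι × Bool → ℝ) => z b)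
      (Measure.pi (duplicatePrior F)) := iIndepFun_pi (X := fun _ x => x) fun _ => aemeasurable_id
  have h := hind.indepFun_prodMk_prodMk (fun b => measurable_pi_apply b) (i, false) (i, true)
    (j, false) (j, true) (by simp [hij]) (by simp [hij]) (by simp [hij]) (by simp [hij])
  exact h.comp (φ := fun p : ℝ × ℝ => max p.1 p.2) (ψ := fun p : ℝ × ℝ => max p.1 p.2)
    (by fun_prop) (by fun_prop)

/-- The buyer `0` with the deterministic value `a` and `k` buyers with exponential values. -/
def oneOrOthersPrior (k : ℕ) (a : ℝ) : Fin (k + 1) → Measure ℝ :=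
  Fin.cons (Measure.dirac a) fun _ => expMeasure 1

theorem isMHR_oneOrOthersPrior (k : ℕ) {a : ℝ} (ha : 0 ≤ a) (i : Fin (k + 1)) :
    IsMHR (oneOrOthersPrior k a i) := by
  refine Fin.cases ?_ (fun i => ?_) i
  · exact isMHR_dirac ha
  · exact isMHR_expMeasure

/-- Chebyshev's inequality: the high values of the `k` exponential buyers are independent with mean
`3/2` and common variance. -/
theorem measure_sum_highValue_lt_le (k : ℕ) {a d : ℝ} (ha : 0 ≤ a) (hd : 0 < d) :
    Measure.pi (duplicatePrior (oneOrOthersPrior k a))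
        {z | ∑ i : Fin k, highValue z i.succ < 3 / 2 * k - d} ≤
      ENNReal.ofReal (k * Var[fun p : ℝ × ℝ => max p.1 p.2;
        (expMeasure 1).prod (expMeasure 1)] / d ^ 2) := by
  have hF := fun i => (isMHR_oneOrOthersPrior k ha i).isProbabilityMeasure
  have hprob : ∀ b, IsProbabilityMeasure (duplicatePrior (oneOrOthersPrior k a) b) :=
    fun b => hF b.1
  set Q := Measure.pi (duplicatePrior (oneOrOthersPrior k a))
  have hmp : ∀ i : Fin k, MeasurePreserving
      (fun z : Fin (k + 1) × Bool → ℝ => (z (i.succ, false), z (i.succ, true))) Q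
      ((expMeasure 1).prod (expMeasure 1)) := fun i => measurePreserving_pair hF i.succ
  have hmem : ∀ i : Fin k,
      MemLp (fun z : Fin (k + 1) × Bool → ℝ => highValue z i.succ) 2 Q := fun i =>
    memLp_max_expMeasure.comp_measurePreserving (hmp i)
  have hvar : ∀ i : Fin k, Var[fun z : Fin (k + 1) × Bool → ℝ => highValue z i.succ; Q] =
      Var[fun p : ℝ × ℝ => max p.1 p.2; (expMeasure 1).prod (expMeasure 1)] := fun i => by
    rw [← (hmp i).map_eq, variance_map (by fun_prop) (hmp i).measurable.aemeasurable]
    rfl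
  have hmean : ∀ i : Fin k, ∫ z, highValue z i.succ ∂Q = 3 / 2 := fun i => by
    rw [← integral_max_expMeasure, ← (hmp i).map_eq,
      integral_map (hmp i).measurable.aemeasurable (by fun_prop)]
    rfl
  have hsum : MemLp (∑ i : Fin k, fun z : Fin (k + 1) × Bool → ℝ => highValue z i.succ) 2 Q :=
    memLp_finsetSum' _ fun i _ => hmem i
  have hsummean : ∫ z, (∑ i : Fin k, fun z : Fin (k + 1) × Bool → ℝ => highValue z i.succ) z ∂Q =
      3 / 2 * k := by
    simp only [Finset.sum_apply]
    rw [integral_finsetSum _ fun i _ => (hmem i).integrable one_le_two]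
    simp only [hmean]
    simp [mul_comm]
  have hcheb := meas_ge_le_variance_div_sq hsum hd
  rw [IndepFun.variance_sum (fun i _ => hmem i) (fun i _ j _ hij =>
    indepFun_highValue hF ((Fin.succ_injective k).ne hij)), hsummean] at hcheb
  simp only [hvar, Finset.sum_const, Finset.card_univ, Fintype.card_fin, nsmul_eq_mul,
    Finset.sum_apply] at hcheb
  refine (measure_mono fun z hz => ?_).trans hcheb
  rw [Set.mem_ofPred_eq] at hz ⊢
  rw [abs_sub_comm]
  exact le_trans (by linarith) (le_abs_self _)

/-- The three terms are the duplicates' values, the quadratic correction for pivotal winners, and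
the shortfall event; `had` makes the cut-off `a + d` the one controlled by Chebyshev. -/
theorem revenue_oneOrOthers_le (k : ℕ) {a d : ℝ} (ha : 0 ≤ a) (hd : 0 < d)
    (had : a + d = 3 / 2 * k - d) {M : Mechanism (Fin (k + 1) × Bool)}
    (hM : M.IsVCG (duplicateFeasible (oneOrOthers k))) :
    M.revenue (duplicatePrior (oneOrOthersPrior k a)) ≤ ENNReal.ofReal (k * (1 / 2) +
      k * ((∫ p, max p.1 p.2 ^ 2 ∂((expMeasure 1).prod (expMeasure 1))) / (4 * d)) +
      (a + d) * (k * Var[fun p : ℝ × ℝ => max p.1 p.2;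
        (expMeasure 1).prod (expMeasure 1)] / d ^ 2)) := by
  have hF := fun i => (isMHR_oneOrOthersPrior k ha i).isProbabilityMeasure
  have hprob : ∀ b, IsProbabilityMeasure (duplicatePrior (oneOrOthersPrior k a) b) :=
    fun b => hF b.1
  have := isProbabilityMeasure_expMeasure one_pos
  have hcheb := measure_sum_highValue_lt_le k ha hd
  set Q := Measure.pi (duplicatePrior (oneOrOthersPrior k a))
  set V := Var[fun p : ℝ × ℝ => max p.1 p.2; (expMeasure 1).prod (expMeasure 1)]
  have hV : 0 ≤ V := variance_nonneg _ _
  have hmp : ∀ i : Fin k, MeasurePreserving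
      (fun z : Fin (k + 1) × Bool → ℝ => (z (i.succ, false), z (i.succ, true))) Q
      ((expMeasure 1).prod (expMeasure 1)) := fun i => measurePreserving_pair hF i.succ
  have hlow : ∀ i : Fin k, ∫⁻ z, ENNReal.ofReal (lowValue z i.succ) ∂Q = ENNReal.ofReal (1 / 2) :=
    fun i => by
      rw [← lintegral_min_expMeasure, ← (hmp i).lintegral_comp (by fun_prop)]
      rfl
  have hsq : ∀ i : Fin k, ∫⁻ z, ENNReal.ofReal (highValue z i.succ ^ 2 / (4 * d)) ∂Q =
      ENNReal.ofReal ((∫ p, max p.1 p.2 ^ 2 ∂((expMeasure 1).prod (expMeasure 1))) / (4 * d)) :=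
    fun i => by
      rw [← integral_div, ofReal_integral_eq_lintegral_ofReal
        (memLp_max_expMeasure.integrable_sq.div_const _) (ae_of_all _ fun p => by positivity),
        ← (hmp i).lintegral_comp (by fun_prop)]
      rfl
  have hm : ∀ i, Measurable fun z : Fin (k + 1) × Bool → ℝ => highValue z i :=
    measurable_pi_iff.1 measurable_highValue
  have hm' : ∀ i, Measurable fun z : Fin (k + 1) × Bool → ℝ => lowValue z i :=
    measurable_pi_iff.1 measurable_lowValue
  have hset : MeasurableSet {z : Fin (k + 1) × Bool → ℝ |
      ∑ i : Fin k, highValue z i.succ < 3 / 2 * k - d} :=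
    measurableSet_lt (Finset.measurable_sum _ fun i _ => hm i.succ) measurable_const
  have hint2 : ∫⁻ z, ENNReal.ofReal (if ∑ i : Fin k, highValue z i.succ < a + d then a + d else 0)
      ∂Q ≤ ENNReal.ofReal (a + d) * ENNReal.ofReal (k * V / d ^ 2) := by
    refine le_trans (le_of_eq ?_) (mul_le_mul_right hcheb _)
    rw [← lintegral_indicator_const hset]
    refine lintegral_congr fun z => ?_
    rw [Set.indicator_apply, had]
    simp only [Set.mem_ofPred_eq]
    split_ifs <;> simp
  have hC : 0 ≤ ∫ p, max p.1 p.2 ^ 2 ∂((expMeasure 1).prod (expMeasure 1)) :=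
    integral_nonneg fun p => by positivity
  rw [ENNReal.ofReal_add (by positivity) (by positivity), ENNReal.ofReal_add (by positivity)
    (by positivity), ENNReal.ofReal_mul (p := (a + d)) (by positivity)]
  refine le_trans ?_ (add_le_add_right hint2 _)
  have hzero : ∀ β, ∀ᵐ z ∂Q, z (0, β) = a := fun β =>
    (measurePreserving_eval (duplicatePrior (oneOrOthersPrior k a)) (0, β)).quasiMeasurePreserving.ae
      (p := fun x => x = a) (by
        change ∀ᵐ x ∂(Measure.dirac a), x = a
        exact (ae_dirac_iff (p := fun x => x = a) (measurableSet_singleton a)).2 rfl)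
  calc M.revenue (duplicatePrior (oneOrOthersPrior k a)) ≤
      ∫⁻ z, (∑ i : Fin k, ENNReal.ofReal (lowValue z i.succ) +
        ∑ i : Fin k, ENNReal.ofReal (highValue z i.succ ^ 2 / (4 * d))) +
        ENNReal.ofReal (if ∑ i : Fin k, highValue z i.succ < a + d then a + d else 0) ∂Q := by
        refine lintegral_mono_ae ?_
        filter_upwards [hzero false, hzero true, ae_pi_nonneg
          (G := duplicatePrior (oneOrOthersPrior k a))
          fun b => (isMHR_oneOrOthersPrior k ha b.1).toIsValuation] with z h1 h2 hz
        rw [hM.sum_pay (isDownwardClosed_oneOrOthers k)]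
        have hl : ∀ i, 0 ≤ lowValue z i := fun i => le_min (hz _) (hz _)
        rw [← ENNReal.ofReal_sum_of_nonneg fun i _ => hl _,
          ← ENNReal.ofReal_sum_of_nonneg fun i _ => by positivity,
          ← ENNReal.ofReal_add (Finset.sum_nonneg fun i _ => hl _)
            (Finset.sum_nonneg fun i _ => by positivity),
          ← ENNReal.ofReal_add (add_nonneg (Finset.sum_nonneg fun i _ => hl _)
            (Finset.sum_nonneg fun i _ => by positivity)) (by split_ifs <;> positivity)]
        exact ENNReal.ofReal_le_ofReal (sum_pay_oneOrOthers_le hd hl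
          (lowValue_le_highValue z) (by simp [highValue, h1, h2]) (by simp [lowValue, h1, h2]))
    _ = _ := by
        rw [lintegral_add_left (by fun_prop), lintegral_add_left (by fun_prop),
          lintegral_finsetSum _ fun i _ => (hm' i.succ).ennreal_ofReal,
          lintegral_finsetSum _ fun i _ => by fun_prop]
        simp only [hlow, hsq, Finset.sum_const, Finset.card_univ, Fintype.card_fin]
        rw [ENNReal.ofReal_mul (Nat.cast_nonneg k), ENNReal.ofReal_mul (Nat.cast_nonneg k),
          ENNReal.ofReal_natCast, nsmul_eq_mul, nsmul_eq_mul]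

theorem VCGGuarantee.le_third {c : ℝ≥0∞}
    (hc : VCGGuarantee IsMHR (fun _ X F => optimalRevenue X F) c) : c ≤ 1 / 3 := by
  by_contra! hlt
  -- A finite `r` in between allows real arithmetic even if `c = ⊤`.
  obtain ⟨r, hr, hrc⟩ := ENNReal.lt_iff_exists_nnreal_btwn.1 hlt
  have hr3 : (1 : ℝ) / 3 < r := by
    have h3 : (1 / 3 : ℝ≥0∞) = ((1 / 3 : NNReal) : ℝ≥0∞) := by
      rw [ENNReal.coe_div (by norm_num)]
      simp
    rw [h3, ENNReal.coe_lt_coe] at hr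
    exact_mod_cast hr
  set C := ∫ p, max p.1 p.2 ^ 2 ∂((expMeasure 1).prod (expMeasure 1))
  set V := Var[fun p : ℝ × ℝ => max p.1 p.2; (expMeasure 1).prod (expMeasure 1)] with hVdef
  have hV : 0 ≤ V := variance_nonneg _ _
  have hC : 0 ≤ C := integral_nonneg fun p => by positivity
  -- This `δ` puts `r (3/2 - 2δ)` halfway between `1/2` and `3r/2`, leaving a surplus of `(3r -
  -- 1)/4` per exponential buyer.
  obtain ⟨δ, hδ, hδ2, hrδ⟩ : ∃ δ : ℝ, 0 < δ ∧ δ < 3 / 8 ∧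
      r * (3 / 2 - 2 * δ) = 1 / 2 + (3 * r - 1) / 4 := by
    refine ⟨(3 * r - 1) / (8 * r), div_pos (by linarith) (by linarith), ?_, ?_⟩
    · rw [div_lt_div_iff₀ (by linarith) (by norm_num)]
      linarith
    · field_simp
      ring
  -- With `d = δ k` and `a = (3/2 - 2δ) k`, both error terms are free of `k`; `D` is their sum, and
  -- the surplus outgrows it for large `k`.
  set D := C / (4 * δ) + (3 / 2 - δ) * V / δ ^ 2 with hD
  obtain ⟨k, hk⟩ := exists_nat_gt (max 1 (D * 4 / (3 * r - 1)))
  have hk1 : (1 : ℝ) < k := (le_max_left _ _).trans_lt hk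
  have hkD : D < k * ((3 * r - 1) / 4) := by
    have := (le_max_right _ _).trans_lt hk
    rw [div_lt_iff₀ (by linarith)] at this
    linarith
  have ha : 0 ≤ (3 / 2 - 2 * δ) * k := by
    apply mul_nonneg <;> linarith
  have hd : 0 < δ * k := by positivity
  obtain ⟨M, hM⟩ := exists_isVCG (X := duplicateFeasible (oneOrOthers k))
    ⟨_, image_copy_mem (isDownwardClosed_oneOrOthers k).empty_mem fun _ => false⟩
  have h := hc (k + 1) (oneOrOthers k) (oneOrOthersPrior k ((3 / 2 - 2 * δ) * k)) M
    (isDownwardClosed_oneOrOthers k) (isMHR_oneOrOthersPrior k ha) hM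
  have hrev := revenue_oneOrOthers_le k ha hd (by ring) hM
  have hopt := le_optimalRevenue_of_dirac (X := oneOrOthers k)
    (fun i => (isMHR_oneOrOthersPrior k ha i).isProbabilityMeasure) (singleton_zero_mem_oneOrOthers k) ha rfl
  have hall : ENNReal.ofReal (r * ((3 / 2 - 2 * δ) * k)) ≤ ENNReal.ofReal (k * (1 / 2) + D) := by
    calc ENNReal.ofReal (r * ((3 / 2 - 2 * δ) * k)) =
          r * ENNReal.ofReal ((3 / 2 - 2 * δ) * k) := by
          rw [ENNReal.ofReal_mul r.coe_nonneg, ENNReal.ofReal_coe_nnreal]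
      _ ≤ c * optimalRevenue (oneOrOthers k) (oneOrOthersPrior k ((3 / 2 - 2 * δ) * k)) := by
          gcongr
      _ ≤ _ := h.trans hrev
      _ = ENNReal.ofReal (k * (1 / 2) + D) := by
          congr 1
          rw [hD, add_assoc]
          congr 1
          have hk0 : (k : ℝ) ≠ 0 := by positivity
          field_simp
          ring
  have hD0 : 0 ≤ D := by
    have : 0 ≤ 3 / 2 - δ := by linarith
    positivity
  rw [ENNReal.ofReal_le_ofReal_iff (by positivity)] at hall
  have : r * ((3 / 2 - 2 * δ) * k) = k * (1 / 2) + k * ((3 * r - 1) / 4) := by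
    rw [← mul_assoc, hrδ]
    ring
  linarith

end TightnessInExpectation

end DuplicateVCG

end

theorem mainTheorem7 :
    -- tight ratio `1/3` for quasi-MHR buyers, against the optimal revenue and optimal welfare
    IsGreatest {c : ℝ≥0∞ | DuplicateVCG.VCGGuarantee DuplicateVCG.IsQuasiMHR
      (fun _ X F => DuplicateVCG.optimalRevenue X F) c} (1 / 3) ∧
    IsGreatest {c : ℝ≥0∞ | DuplicateVCG.VCGGuarantee DuplicateVCG.IsQuasiMHR
      (fun _ X F => DuplicateVCG.optimalWelfare X F) c} (1 / 3) ∧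
    -- no loss with respect to MHR buyers, who form a subclass with the same tight ratio
    (∀ μ : Measure ℝ, DuplicateVCG.IsMHR μ → DuplicateVCG.IsQuasiMHR μ) ∧
    IsGreatest {c : ℝ≥0∞ | DuplicateVCG.VCGGuarantee DuplicateVCG.IsMHR
      (fun _ X F => DuplicateVCG.optimalRevenue X F) c} (1 / 3) := by
  -- Guarantees pass from quasi-MHR with welfare to quasi-MHR with revenue to MHR with revenue. So
  -- `1/3` need only be proved for the first and its optimality only for the last.
  have hrev : ∀ c, DuplicateVCG.VCGGuarantee DuplicateVCG.IsQuasiMHR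
      (fun _ X F => DuplicateVCG.optimalWelfare X F) c →
      DuplicateVCG.VCGGuarantee DuplicateVCG.IsQuasiMHR
        (fun _ X F => DuplicateVCG.optimalRevenue X F) c := fun _ =>
    DuplicateVCG.VCGGuarantee.of_le (fun _ h => h) fun _ _ _ hF =>
      DuplicateVCG.optimalRevenue_le_optimalWelfare fun i => (hF i).toIsValuation
  have hmhr : ∀ c, DuplicateVCG.VCGGuarantee DuplicateVCG.IsQuasiMHR
      (fun _ X F => DuplicateVCG.optimalRevenue X F) c →
      DuplicateVCG.VCGGuarantee DuplicateVCG.IsMHR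
        (fun _ X F => DuplicateVCG.optimalRevenue X F) c := fun _ =>
    DuplicateVCG.VCGGuarantee.of_le (fun _ h => h.isQuasiMHR) fun _ _ _ _ => le_rfl
  have hopt := DuplicateVCG.vcgGuarantee_optimalWelfare
  exact ⟨⟨hrev _ hopt, fun c hc => (hmhr c hc).le_third⟩,
    ⟨hopt, fun c hc => (hmhr c (hrev c hc)).le_third⟩, fun _ h => h.isQuasiMHR,
    hmhr _ (hrev _ hopt), fun _ hc => hc.le_third⟩
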